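/- Let $K$ be an algebraically closed field of characteristic zero, let $X_5 = V(f) \subset \mathbb{P}^3_K$ be a smooth quintic surface, and let $C \subset X_5$ be a twisted cubic, parametrized by $\varphi\colon \mathbb{P}^1 \to C$, $\varphi(s,t) = M\cdot(s^3, s^2t, st^2, t^3)$ with $M \in \mathrm{GL}_4(K)$. For a point $P \in C$ let $T_P = T_P X_5$ be the tangent plane, defined by the linear form $g_P = \sum_i \frac{\partial f}{\partial x_i}(P)\, x_i$, and let $V_P$ be the Hessian quadric, defined by $q_P = \frac12 \sum_{i,j} \frac{\partial^2 f}{\partial x_i \partial x_j}(P)\, x_i x_j$. For $P = \varphi(s,t)$ these are binary forms in $(s,t)$ of degrees $12$ and $9$ with coefficients in $K[x_1,\dots,x_4]$; let $R \in K[x_1,\dots,x_4]$ be their resultant with respect to $(s,t)$. Suppose that a line $\ell \subset X_5$ meets $C$ with multiplicity two, i.e. $\ell$ passes through two distinct points of $C$ or is the tangent line of $C$ at a point of $C$. Then $R$ is a form of degree $33$ whose zero locus is $Z_C = \bigcup_{P \in C} (T_P \cap V_P)$, and $f \nmid R$, so that the surface $Z_C = V(R)$ cuts out an effective divisor $D =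 Z_C \cap X_5 \in |\mathcal{O}_{X_5}(33)|$. Moreover $\ell$ has multiplicity at least two in $D$, i.e. $D - 2\ell$ is effective; the multiplicity of $\ell$ in $D$ is the length of $\big(K[x_1,\dots,x_4]/(f,R)\big)_{I(\ell)}$ over $K[x_1,\dots,x_4]_{I(\ell)}$. -/

import Mathlib

namespace TwistedQuintic

open MvPolynomial

noncomputable section

/-- The cone over a smooth quintic surface `V(f) ⊂ ℙ³`: `f` is a quaternary quintic form whose
partial derivatives have no common zero on `V(f)` away from the origin. -/
def IsSmoothQuintic {K : Type*} [Field K] (f : MvPolynomial (Fin 4) K) : Prop :=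
  f.IsHomogeneous 5 ∧
    ∀ x : Fin 4 → K, x ≠ 0 → eval x f = 0 → ∃ i, eval x (pderiv i f) ≠ 0

/-- The parametrization `φ_M (s, t) = M · (s³, s²t, st², t³)`, with values in any `K`-algebra `A`.
A twisted cubic in `ℙ³` is the image `C_M` of `[s : t] ↦ [φ_M (s, t)]` for an invertible `M`. -/
def cubicPoint {K A : Type*} [Field K] [CommRing A] [Algebra K A]
    (M : Matrix (Fin 4) (Fin 4) K) (u : Fin 2 → A) : Fin 4 → A :=
  fun i => ∑ j : Fin 4, algebraMap K A (M i j) * u 0 ^ (3 - (j : ℕ)) * u 1 ^ (j : ℕ)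

/-- The twisted cubic `C_M` lies on the surface `V(f)`. -/
def CubicOnSurface {K : Type*} [Field K]
    (f : MvPolynomial (Fin 4) K) (M : Matrix (Fin 4) (Fin 4) K) : Prop :=
  ∀ u : Fin 2 → K, eval (cubicPoint M u) f = 0

/-- The cone over the tangent line of `C_M` at the point `φ_M (u)`, spanned by the two partial
derivatives of the parametrization. -/
def cubicTangentLine {K : Type*} [Field K]
    (M : Matrix (Fin 4) (Fin 4) K) (u : Fin 2 → K) : Submodule K (Fin 4 → K) :=
  Submodule.span K (Set.range fun k : Fin 2 =>
    fun i : Fin 4 => eval u (pderiv k (cubicPoint M (X : Fin 2 → MvPolynomial (Fin 2) K) i)))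

/-- The line `ℙ(L)` meets the twisted cubic `C_M` with multiplicity two: either it passes through
two distinct points of `C_M`, or it is the tangent line of `C_M` at one of its points. -/
def MeetsCubicTwice {K : Type*} [Field K]
    (M : Matrix (Fin 4) (Fin 4) K) (L : Submodule K (Fin 4 → K)) : Prop :=
  (∃ u v : Fin 2 → K, LinearIndependent K ![u, v] ∧ cubicPoint M u ∈ L ∧ cubicPoint M v ∈ L) ∨
  (∃ u : Fin 2 → K, u ≠ 0 ∧ L = cubicTangentLine M u)

/-- The linear form in `x` defining the tangent plane `T_p` of `V(f)` at the point `p`. -/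
def tangentForm {K A : Type*} [Field K] [CommRing A] [Algebra K A]
    (f : MvPolynomial (Fin 4) K) (p x : Fin 4 → A) : A :=
  ∑ i, aeval p (pderiv i f) * x i

/-- The quadratic form in `x` defining the Hessian quadric `V_p` of `V(f)` at the point `p`. -/
def hessianForm {K A : Type*} [Field K] [CommRing A] [Algebra K A]
    (f : MvPolynomial (Fin 4) K) (p x : Fin 4 → A) : A :=
  algebraMap K A (1 / 2) * ∑ i, ∑ j, x i * aeval p (pderiv i (pderiv j f)) * x j

/-- (The cone over) `Z_C`, the union over the points `P` of `C_M` of the sets `T_P ∩ V_P`. -/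
def zLocus {K : Type*} [Field K]
    (f : MvPolynomial (Fin 4) K) (M : Matrix (Fin 4) (Fin 4) K) : Set (Fin 4 → K) :=
  {x | ∃ u : Fin 2 → K, u ≠ 0 ∧
    tangentForm f (cubicPoint M u) x = 0 ∧ hessianForm f (cubicPoint M u) x = 0}

/-- The form defining `Z_C` as a surface: the resultant of the tangent form and of the Hessian form
at `φ_M (s, t)`, which are binary forms of degrees `12` and `9` in `(s, t)` with coefficients in
`K[x₁, …, x₄]`. Mathlib's `resultant` is the determinant of the Sylvester matrix of the prescribed
size `12 + 9`, formed from the coefficients of `s^(12-k) t^k` and `s^(9-k) t^k`, so that one may set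
`s = 1` without losing information. -/
def zForm {K : Type*} [Field K]
    (f : MvPolynomial (Fin 4) K) (M : Matrix (Fin 4) (Fin 4) K) : MvPolynomial (Fin 4) K :=
  Polynomial.resultant
    (tangentForm f (cubicPoint M ![1, Polynomial.X])
      (fun i => Polynomial.C (X i : MvPolynomial (Fin 4) K)))
    (hessianForm f (cubicPoint M ![1, Polynomial.X])
      (fun i => Polynomial.C (X i : MvPolynomial (Fin 4) K)))
    12 9

/-- The ideal of the linear subspace `ℙ(L)` is prime. -/
instance vanishingIdeal_isPrime {K : Type*} [Field K] [Infinite K]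
    (L : Submodule K (Fin 4 → K)) : (vanishingIdeal K (L : Set (Fin 4 → K))).IsPrime := by
  constructor
  · intro h
    have h1 : (1 : MvPolynomial (Fin 4) K) ∈ vanishingIdeal K (L : Set (Fin 4 → K)) := by
      rw [h]; trivial
    have := h1 0 L.zero_mem
    simp at this
  · intro p q hpq
    by_contra! hc
    obtain ⟨hp, hq⟩ := hc
    simp only [mem_vanishingIdeal_iff, not_forall] at hp hq
    obtain ⟨x, hx, hpx⟩ := hp
    obtain ⟨y, hy, hqy⟩ := hq
    let γ : Fin 4 → Polynomial K :=
      fun i => Polynomial.C (x i) + Polynomial.X * Polynomial.C (y i - x i)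
    have key : ∀ (t : K) (r : MvPolynomial (Fin 4) K),
        (aeval γ r).eval t = aeval (x + t • (y - x)) r := by
      intro t r
      have h2 := congrArg (fun g : MvPolynomial (Fin 4) K →ₐ[K] K => g r)
        (MvPolynomial.comp_aeval (R := K) (f := γ) (Polynomial.aeval t))
      simp only [AlgHom.comp_apply] at h2
      rw [Polynomial.coe_aeval_eq_eval] at h2
      rw [h2]
      congr 2
      funext i
      simp [γ, smul_eq_mul]
    have hz : aeval γ p * aeval γ q = 0 := by
      apply Polynomial.funext
      intro t
      rw [← map_mul, key t]
      simpa using hpq _ (L.add_mem hx (L.smul_mem t (L.sub_mem hy hx)))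
    rcases mul_eq_zero.mp hz with h | h
    · apply hpx
      have := key 0 p
      rw [h] at this
      simpa using this.symm
    · apply hqy
      have := key 1 q
      rw [h] at this
      simpa using this.symm

/-- The intersection multiplicity of the surfaces `V(f)` and `V(F)` in `ℙ³` along the integral
closed subscheme with homogeneous prime ideal `𝔭`: the length of `(S / (f, F))_𝔭` over `S_𝔭`, where
`S = K[x₁, …, x₄]`. If `V(f)` is a smooth surface not contained in `V(F)` and `𝔭` is the ideal of a
curve on `V(f)`, this is the multiplicity of the curve in the divisor cut out by `F` on `V(f)`. -/
def intersectionMult {K : Type*} [Field K] (𝔭 : Ideal (MvPolynomial (Fin 4) K)) [𝔭.IsPrime]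
    (f F : MvPolynomial (Fin 4) K) : ℕ∞ :=
  Module.length (Localization.AtPrime 𝔭)
    (Localization.AtPrime 𝔭 ⧸ Ideal.span
      {algebraMap (MvPolynomial (Fin 4) K) (Localization.AtPrime 𝔭) f,
        algebraMap (MvPolynomial (Fin 4) K) (Localization.AtPrime 𝔭) F})

end

end TwistedQuintic

/-! `zForm` is the determinant of a Sylvester matrix, and each assertion is read off from that
matrix or from specializing it.

Multiplicity. Pairing the rows with the monomials of degree 20 at a parameter `u` gives multiples of
the tangent and Hessian forms at `φ(u)` (`sum_monomial_mul_sylvester`). If `φ(u)` lies on a line `L`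
contained in the surface, both forms vanish on `L`, so this row combination has entries in the ideal
`𝔭` of `L`. A secant gives two such combinations, one for each point. A tangent line gives two as
well, from the partial derivatives of the monomials, because the forms in a direction of `L` vanish
to second order at `u`. Two independent combinations put the determinant in `𝔭²`
(`det_mem_sq_of_linearIndependent`). As `𝔭/𝔭²` has rank two, `(f) + 𝔭²` stays strictly smaller than
the maximal ideal after localization, so the length is at least two (`two_le_intersectionMult`).

Non-divisibility (`not_dvd_zForm`). Take a generic point `x` of the surface over an algebraically
closed `E` with derivations `D₁`, `D₂` for which `x, D₁x, D₂x` are independent. If `f` divided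
`zForm`, there would be a point `p` of the cubic over `E` with `x ∈ T_p ∩ V_p`. Some combination `D`
of the derivations fixes `p` and moves `x`. If `x` moves towards `p`, the line `px` has contact of
order three with the surface at both ends. A quintic on a line has six coefficients, so the line
lies on the surface (`aeval_line_eq_zero`). Lines on a smooth quintic are rigid, their normal bundle
having degree -3 (`false_of_moving_line`), so `x` could not move in two directions. A constant `p`
always leads to this case. Otherwise, the second fundamental form at `p` vanishes
(`hess_eq_zero_of_grad_dotProduct_eq_zero`). Then the tangent plane is stationary along the cubic
and contains all its osculating vectors, which is impossible for a nondegenerate curve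
(`false_of_moving_point`). -/

namespace TwistedQuintic

open MvPolynomial

/-! ### Binary forms, dehomogenization and the Sylvester matrix. -/

section BinaryForms

variable {K R A : Type*} [Field K] [CommRing R] [CommRing A] [Algebra K R] [Algebra K A]
  [Algebra R A] [IsScalarTower K R A]

/-- The value at `u` of the binary form of degree `n` whose dehomogenization is `P`. -/
noncomputable def homEval (n : ℕ) (P : Polynomial R) (u : Fin 2 → A) : A :=
  ∑ k ∈ Finset.range (n + 1), algebraMap R A (P.coeff k) * u 0 ^ (n - k) * u 1 ^ k

lemma aeval_dehomog_eq_sum (B : MvPolynomial (Fin 2) K) :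
    (aeval ![1, Polynomial.X] B : Polynomial R) =
      ∑ d ∈ B.support, Polynomial.C (algebraMap K R (B.coeff d)) * Polynomial.X ^ d 1 := by
  conv_lhs => rw [B.as_sum]
  rw [map_sum]
  refine Finset.sum_congr rfl fun d _ => ?_
  rw [aeval_monomial, Finsupp.prod_fintype _ _ (fun _ => pow_zero _)]
  simp [Fin.prod_univ_two, Polynomial.algebraMap_apply]

lemma degree_of_mem_support {B : MvPolynomial (Fin 2) K} {n : ℕ} (hB : B.IsHomogeneous n)
    {d : Fin 2 →₀ ℕ} (hd : d ∈ B.support) : d 0 + d 1 = n := by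
  have := hB (mem_support_iff.mp hd)
  rw [Finsupp.weight_apply, Finsupp.sum_fintype _ _ (by simp)] at this
  simpa [Fin.sum_univ_two] using this

lemma natDegree_aeval_dehomog_le {B : MvPolynomial (Fin 2) K} {n : ℕ} (hB : B.IsHomogeneous n) :
    (aeval ![1, Polynomial.X] B : Polynomial R).natDegree ≤ n := by
  rw [aeval_dehomog_eq_sum]
  refine Polynomial.natDegree_sum_le_of_forall_le _ _ fun d hd => ?_
  refine (Polynomial.natDegree_C_mul_X_pow_le _ _).trans ?_
  have := degree_of_mem_support hB hd
  omega

lemma homEval_add (n : ℕ) (P Q : Polynomial R) (u : Fin 2 → A) :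
    homEval n (P + Q) u = homEval n P u + homEval n Q u := by
  simp [homEval, add_mul, Finset.sum_add_distrib]

lemma homEval_C_mul (n : ℕ) (c : R) (P : Polynomial R) (u : Fin 2 → A) :
    homEval n (Polynomial.C c * P) u = algebraMap R A c * homEval n P u := by
  simp [homEval, Finset.mul_sum, mul_assoc]

lemma homEval_sum {ι : Type*} (n : ℕ) (s : Finset ι) (P : ι → Polynomial R) (u : Fin 2 → A) :
    homEval n (∑ i ∈ s, P i) u = ∑ i ∈ s, homEval n (P i) u := by
  classical
  induction s using Finset.induction_on with
  | empty => simp [homEval]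
  | insert a s ha ih => rw [Finset.sum_insert ha, homEval_add, ih, Finset.sum_insert ha]

lemma homEval_X_pow {n j : ℕ} (hj : j ≤ n) (u : Fin 2 → A) :
    homEval n (Polynomial.X ^ j : Polynomial R) u = u 0 ^ (n - j) * u 1 ^ j := by
  rw [homEval, Finset.sum_eq_single j]
  · simp
  · intro b _ hb
    simp [Polynomial.coeff_X_pow, hb]
  · intro h
    exact absurd (Finset.mem_range.mpr (by omega)) h

lemma homEval_aeval_dehomog {B : MvPolynomial (Fin 2) K} {n : ℕ} (hB : B.IsHomogeneous n)
    (u : Fin 2 → A) :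
    homEval n (aeval ![1, Polynomial.X] B : Polynomial R) u = aeval u B := by
  rw [aeval_dehomog_eq_sum, homEval_sum]
  conv_rhs => rw [B.as_sum]
  rw [map_sum]
  refine Finset.sum_congr rfl fun d hd => ?_
  have h := degree_of_mem_support hB hd
  rw [homEval_C_mul, homEval_X_pow (by omega), aeval_monomial,
    Finsupp.prod_fintype _ _ (fun _ => pow_zero _), Fin.prod_univ_two,
    ← IsScalarTower.algebraMap_apply K R A, show n - d 1 = d 0 by omega]

lemma homEval_one_right (n : ℕ) (P : Polynomial R) (hP : P.natDegree ≤ n) (t : R) :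
    homEval n P ![1, t] = P.eval t := by
  rw [homEval, Polynomial.eval_eq_sum_range' (Nat.lt_succ_of_le hP)]
  simp

lemma homEval_zero_one (n : ℕ) (P : Polynomial R) :
    homEval n P (![0, 1] : Fin 2 → R) = P.coeff n := by
  rw [homEval, Finset.sum_eq_single n]
  · simp
  · intro b hb hbn
    have : n - b ≠ 0 := by have := Finset.mem_range.mp hb; omega
    simp [this]
  · intro h
    simp at h

/-- A Sylvester column is the coefficient vector of `P` shifted by `j`, that is, of the form
`s^(m-1-j) t^j P`, and pairing it with the monomials evaluates that form. -/
lemma sum_sylvester_aux (m n j : ℕ) (hj : j < m) (P : Polynomial R) (u : Fin 2 → A) :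
    ∑ i : Fin (m + n), u 0 ^ (m + n - 1 - i) * u 1 ^ (i : ℕ) *
      algebraMap R A (if (i : ℕ) ∈ Set.Icc j (j + n) then P.coeff (i - j) else 0) =
      u 0 ^ (m - 1 - j) * u 1 ^ j * homEval n P u := by
  rw [Fin.sum_univ_eq_sum_range (fun i => u 0 ^ (m + n - 1 - i) * u 1 ^ i *
      algebraMap R A (if i ∈ Set.Icc j (j + n) then P.coeff (i - j) else 0)) (m + n), homEval,
    Finset.mul_sum]
  symm
  refine Finset.sum_of_injOn (fun k => k + j) (fun a _ b _ h => by simpa using h) ?_ ?_ ?_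
  · intro k hk
    simp only [Finset.coe_range, Set.mem_Iio] at hk ⊢
    omega
  · intro i hi hi'
    rw [if_neg, map_zero, mul_zero]
    intro h
    apply hi'
    refine ⟨i - j, ?_, ?_⟩
    · simp only [Finset.coe_range, Set.mem_Iio]
      have := h.1; have := h.2; omega
    · have := h.1
      simp only
      omega
  · intro k hk
    have hk' := Finset.mem_range.mp hk
    rw [if_pos ⟨by omega, by omega⟩, show m + n - 1 - (k + j) = (m - 1 - j) + (n - k) by omega,
      show k + j - j = k by omega, pow_add, pow_add]
    ring

/-- Pairing a column of the Sylvester matrix with the monomials of degree `m + n - 1` at `u`. -/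
lemma sum_monomial_mul_sylvester (m n : ℕ) (F G : Polynomial R) (u : Fin 2 → A)
    (j : Fin (m + n)) :
    ∑ i : Fin (m + n), u 0 ^ (m + n - 1 - i) * u 1 ^ (i : ℕ) *
        algebraMap R A (Polynomial.sylvester F G m n i j) =
      j.addCases (fun j₁ : Fin m => u 0 ^ (m - 1 - j₁) * u 1 ^ (j₁ : ℕ) * homEval n G u)
        (fun j₁ : Fin n => u 0 ^ (n - 1 - j₁) * u 1 ^ (j₁ : ℕ) * homEval m F u) := by
  induction j using Fin.addCases with
  | left j =>
    simp only [Polynomial.sylvester, Matrix.of_apply, Fin.addCases_left]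
    exact sum_sylvester_aux m n j j.2 G u
  | right j =>
    simp only [Polynomial.sylvester, Matrix.of_apply, Fin.addCases_right]
    rw [← sum_sylvester_aux n m j j.2 F u]
    rw [Fin.sum_univ_eq_sum_range (fun i => u 0 ^ (m + n - 1 - i) * u 1 ^ i *
      algebraMap R A (if i ∈ Set.Icc (j : ℕ) (j + m) then F.coeff (i - j) else 0)) (m + n),
      Fin.sum_univ_eq_sum_range (fun i => u 0 ^ (n + m - 1 - i) * u 1 ^ i *
      algebraMap R A (if i ∈ Set.Icc (j : ℕ) (j + m) then F.coeff (i - j) else 0)) (n + m),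
      add_comm m n]

end BinaryForms

/-! ### Vanishing of resultants of prescribed sizes. -/

/-- A resultant of prescribed sizes vanishes iff the two binary forms have a common zero in the
projective line, possibly at infinity. -/
lemma resultant_eq_zero_iff_exists_root {k : Type*} [Field k] [IsAlgClosed k]
    {F G : Polynomial k} {m n : ℕ} (hm : m ≠ 0) (hn : n ≠ 0) (hF : F.natDegree ≤ m)
    (hG : G.natDegree ≤ n) :
    Polynomial.resultant F G m n = 0 ↔
      (∃ t, F.eval t = 0 ∧ G.eval t = 0) ∨ (F.coeff m = 0 ∧ G.coeff n = 0) := by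
  have base : (F ≠ 0 ∨ G ≠ 0) → (Polynomial.resultant F G = 0 ↔
      ∃ t, F.eval t = 0 ∧ G.eval t = 0) := by
    intro h0
    rw [Polynomial.resultant_eq_zero_iff, and_iff_right h0]
    constructor
    · intro h
      by_contra! hc
      apply h
      rw [Polynomial.isCoprime_iff_aeval_ne_zero_of_isAlgClosed k k]
      intro a
      simp only [Polynomial.coe_aeval_eq_eval]
      by_cases ha : F.eval a = 0
      · exact Or.inr (hc a ha)
      · exact Or.inl ha
    · rintro ⟨t, h1, h2⟩ ⟨a, b, hab⟩
      have := congrArg (Polynomial.eval t) hab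
      simp [h1, h2] at this
  by_cases hFm : F.coeff m = 0
  · by_cases hGn : G.coeff n = 0
    · simp only [hFm, hGn, and_self, or_true, iff_true]
      have h1 : F.natDegree < m ∨ F = 0 := by
        rcases hF.lt_or_eq with h | h
        · exact Or.inl h
        · right
          rw [← h] at hFm
          exact Polynomial.leadingCoeff_eq_zero.mp hFm
      have h2 : G.natDegree < n ∨ G = 0 := by
        rcases hG.lt_or_eq with h | h
        · exact Or.inl h
        · right
          rw [← h] at hGn
          exact Polynomial.leadingCoeff_eq_zero.mp hGn
      have h1' : F.natDegree < m := by
        rcases h1 with h | rfl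
        · exact h
        · simpa using Nat.pos_of_ne_zero hm
      have h2' : G.natDegree < n := by
        rcases h2 with h | rfl
        · exact h
        · simpa using Nat.pos_of_ne_zero hn
      exact Polynomial.resultant_eq_zero_of_lt_lt _ _ _ _ h1' h2'
    · have hGd : G.natDegree = n := by
        refine le_antisymm hG (Polynomial.le_natDegree_of_ne_zero hGn)
      have hG0 : G ≠ 0 := by rintro rfl; simp at hGn
      obtain ⟨k, rfl⟩ := Nat.exists_eq_add_of_le hF
      -- `G` has exact degree `n`, so lowering the size of `F` to its degree only splits off a power
      -- of the nonzero top coefficient of `G`, up to sign.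
      rw [Polynomial.resultant_add_left_deg _ _ _ _ _ le_rfl]
      simp only [mul_eq_zero, pow_eq_zero_iff', hGn, false_and, or_false, and_false]
      subst hGd
      rw [base (Or.inr hG0)]
      simp
  · have hFd : F.natDegree = m := by
      refine le_antisymm hF (Polynomial.le_natDegree_of_ne_zero hFm)
    have hF0 : F ≠ 0 := by rintro rfl; simp at hFm
    obtain ⟨k, rfl⟩ := Nat.exists_eq_add_of_le hG
    rw [Polynomial.resultant_add_right_deg _ _ _ _ _ le_rfl]
    simp only [mul_eq_zero, pow_eq_zero_iff', hFm, false_and, or_false, false_or]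
    subst hFd
    rw [base (Or.inl hF0)]

/-! ### Tangent and Hessian forms along the cubic, and the zero locus of `zForm`. -/

section Forms

variable {K : Type*} [Field K] {R A : Type*} [CommRing R] [CommRing A] [Algebra K R] [Algebra K A]

lemma map_cubicPoint (ψ : R →ₐ[K] A) (M : Matrix (Fin 4) (Fin 4) K) (u : Fin 2 → R) :
    (fun i => ψ (cubicPoint M u i)) = cubicPoint M (fun k => ψ (u k)) := by
  funext i
  simp [cubicPoint]

lemma map_aeval_comp {σ : Type*} (ψ : R →ₐ[K] A) (h : MvPolynomial σ K) (p : σ → R) :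
    ψ (aeval p h) = aeval (fun i => ψ (p i)) h := by
  have := congrArg (fun g : MvPolynomial σ K →ₐ[K] A => g h) (comp_aeval (f := p) ψ)
  exact this

lemma map_tangentForm (ψ : R →ₐ[K] A) (f : MvPolynomial (Fin 4) K) (p x : Fin 4 → R) :
    ψ (tangentForm f p x) = tangentForm f (fun i => ψ (p i)) (fun i => ψ (x i)) := by
  simp [tangentForm, map_aeval_comp]

lemma map_hessianForm (ψ : R →ₐ[K] A) (f : MvPolynomial (Fin 4) K) (p x : Fin 4 → R) :
    ψ (hessianForm f p x) = hessianForm f (fun i => ψ (p i)) (fun i => ψ (x i)) := by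
  simp only [hessianForm, map_mul, map_sum, map_aeval_comp, AlgHom.commutes]

lemma map_tangentForm_cubicPoint (ψ : R →ₐ[K] A) (f : MvPolynomial (Fin 4) K)
    (M : Matrix (Fin 4) (Fin 4) K) (u : Fin 2 → R) (x : Fin 4 → R) :
    ψ (tangentForm f (cubicPoint M u) x) =
      tangentForm f (cubicPoint M fun k => ψ (u k)) (fun i => ψ (x i)) := by
  rw [map_tangentForm, map_cubicPoint]

lemma map_hessianForm_cubicPoint (ψ : R →ₐ[K] A) (f : MvPolynomial (Fin 4) K)
    (M : Matrix (Fin 4) (Fin 4) K) (u : Fin 2 → R) (x : Fin 4 → R) :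
    ψ (hessianForm f (cubicPoint M u) x) =
      hessianForm f (cubicPoint M fun k => ψ (u k)) (fun i => ψ (x i)) := by
  rw [map_hessianForm, map_cubicPoint]

lemma cubicPoint_X_isHomogeneous (M : Matrix (Fin 4) (Fin 4) K) (i : Fin 4) :
    (cubicPoint M (X : Fin 2 → MvPolynomial (Fin 2) K) i).IsHomogeneous 3 := by
  unfold cubicPoint
  refine IsHomogeneous.sum _ _ _ fun j _ => ?_
  have h : 0 + 1 * (3 - (j : ℕ)) + 1 * (j : ℕ) = 3 := by have := j.2; omega
  have := (((isHomogeneous_C (Fin 2) (M i j)).mul ((isHomogeneous_X K (0 : Fin 2)).pow (3 - j))).mul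
    ((isHomogeneous_X K (1 : Fin 2)).pow j))
  rw [h] at this
  exact this

/-- A form on `ℙ³` restricted to the twisted cubic, as a binary form. -/
lemma aeval_cubicPoint_X_isHomogeneous (M : Matrix (Fin 4) (Fin 4) K) {h : MvPolynomial (Fin 4) K}
    {d : ℕ} (hh : h.IsHomogeneous d) :
    (aeval (cubicPoint M (X : Fin 2 → MvPolynomial (Fin 2) K)) h).IsHomogeneous (3 * d) :=
  hh.aeval _ (cubicPoint_X_isHomogeneous M)

lemma aeval_aeval_cubicPoint_X (M : Matrix (Fin 4) (Fin 4) K) (h : MvPolynomial (Fin 4) K)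
    (u : Fin 2 → A) :
    aeval u (aeval (cubicPoint M (X : Fin 2 → MvPolynomial (Fin 2) K)) h) =
      aeval (cubicPoint M u) h := by
  rw [map_aeval_comp (aeval u), map_cubicPoint]
  simp

lemma natDegree_aeval_cubicPoint_le (M : Matrix (Fin 4) (Fin 4) K) {h : MvPolynomial (Fin 4) K}
    {d : ℕ} (hh : h.IsHomogeneous d) :
    (aeval (cubicPoint M ![1, (Polynomial.X : Polynomial R)]) h).natDegree ≤ 3 * d := by
  rw [← aeval_aeval_cubicPoint_X]
  exact natDegree_aeval_dehomog_le (aeval_cubicPoint_X_isHomogeneous M hh)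

lemma homEval_aeval_cubicPoint [Algebra R A] [IsScalarTower K R A] (M : Matrix (Fin 4) (Fin 4) K)
    {h : MvPolynomial (Fin 4) K} {d : ℕ} (hh : h.IsHomogeneous d) (u : Fin 2 → A) :
    homEval (3 * d) (aeval (cubicPoint M ![1, (Polynomial.X : Polynomial R)]) h) u =
      aeval (cubicPoint M u) h := by
  rw [← aeval_aeval_cubicPoint_X, homEval_aeval_dehomog (aeval_cubicPoint_X_isHomogeneous M hh),
    aeval_aeval_cubicPoint_X]

variable {f : MvPolynomial (Fin 4) K}

lemma hessian_isHomogeneous (hf : f.IsHomogeneous 5) (i j : Fin 4) :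
    (pderiv i (pderiv j f)).IsHomogeneous 3 :=
  (hf.pderiv (i := j)).pderiv

/-- The tangent form along the twisted cubic as a polynomial in the affine parameter. -/
noncomputable def tangentPoly (f : MvPolynomial (Fin 4) K) (M : Matrix (Fin 4) (Fin 4) K)
    (x : Fin 4 → R) : Polynomial R :=
  tangentForm f (cubicPoint M ![1, Polynomial.X]) (fun i => Polynomial.C (x i))

/-- The Hessian form along the twisted cubic as a polynomial in the affine parameter. -/
noncomputable def hessianPoly (f : MvPolynomial (Fin 4) K) (M : Matrix (Fin 4) (Fin 4) K)
    (x : Fin 4 → R) : Polynomial R :=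
  hessianForm f (cubicPoint M ![1, Polynomial.X]) (fun i => Polynomial.C (x i))

lemma tangentPoly_eq (M : Matrix (Fin 4) (Fin 4) K) (x : Fin 4 → R) :
    tangentPoly f M x = ∑ i, Polynomial.C (x i) *
      aeval (cubicPoint M ![1, (Polynomial.X : Polynomial R)]) (pderiv i f) := by
  rw [tangentPoly, tangentForm]
  exact Finset.sum_congr rfl fun i _ => mul_comm _ _

lemma hessianPoly_eq (M : Matrix (Fin 4) (Fin 4) K) (x : Fin 4 → R) :
    hessianPoly f M x = ∑ i, ∑ j, Polynomial.C (algebraMap K R (1 / 2) * (x i * x j)) *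
      aeval (cubicPoint M ![1, (Polynomial.X : Polynomial R)]) (pderiv i (pderiv j f)) := by
  rw [hessianPoly, hessianForm, Finset.mul_sum]
  refine Finset.sum_congr rfl fun i _ => ?_
  rw [Finset.mul_sum]
  refine Finset.sum_congr rfl fun j _ => ?_
  rw [Polynomial.algebraMap_apply, map_mul, map_mul]
  ring

lemma natDegree_tangentPoly_le (hf : f.IsHomogeneous 5) (M : Matrix (Fin 4) (Fin 4) K)
    (x : Fin 4 → R) : (tangentPoly f M x).natDegree ≤ 12 := by
  rw [tangentPoly_eq]
  refine Polynomial.natDegree_sum_le_of_forall_le _ _ fun i _ => ?_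
  exact (Polynomial.natDegree_C_mul_le _ _).trans (natDegree_aeval_cubicPoint_le M hf.pderiv)

lemma natDegree_hessianPoly_le (hf : f.IsHomogeneous 5) (M : Matrix (Fin 4) (Fin 4) K)
    (x : Fin 4 → R) : (hessianPoly f M x).natDegree ≤ 9 := by
  rw [hessianPoly_eq]
  refine Polynomial.natDegree_sum_le_of_forall_le _ _ fun i _ => ?_
  refine Polynomial.natDegree_sum_le_of_forall_le _ _ fun j _ => ?_
  exact (Polynomial.natDegree_C_mul_le _ _).trans
    (natDegree_aeval_cubicPoint_le M (hessian_isHomogeneous hf i j))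

lemma homEval_tangentPoly [Algebra R A] [IsScalarTower K R A] (hf : f.IsHomogeneous 5)
    (M : Matrix (Fin 4) (Fin 4) K) (x : Fin 4 → R) (u : Fin 2 → A) :
    homEval 12 (tangentPoly f M x) u =
      tangentForm f (cubicPoint M u) (fun i => algebraMap R A (x i)) := by
  rw [tangentPoly_eq, homEval_sum, tangentForm]
  refine Finset.sum_congr rfl fun i _ => ?_
  rw [homEval_C_mul, homEval_aeval_cubicPoint M (d := 4) hf.pderiv, mul_comm]

lemma homEval_hessianPoly [Algebra R A] [IsScalarTower K R A] (hf : f.IsHomogeneous 5)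
    (M : Matrix (Fin 4) (Fin 4) K) (x : Fin 4 → R) (u : Fin 2 → A) :
    homEval 9 (hessianPoly f M x) u =
      hessianForm f (cubicPoint M u) (fun i => algebraMap R A (x i)) := by
  rw [hessianPoly_eq, homEval_sum, hessianForm, Finset.mul_sum]
  refine Finset.sum_congr rfl fun i _ => ?_
  rw [homEval_sum, Finset.mul_sum]
  refine Finset.sum_congr rfl fun j _ => ?_
  rw [homEval_C_mul, homEval_aeval_cubicPoint M (d := 3) (hessian_isHomogeneous hf i j), map_mul,
    map_mul, ← IsScalarTower.algebraMap_apply K R A]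
  ring

lemma mapAlgHom_comp_dehomog (ψ : R →ₐ[K] A) :
    (fun k : Fin 2 => Polynomial.mapAlgHom ψ ((![1, Polynomial.X] : Fin 2 → Polynomial R) k)) =
      ![1, Polynomial.X] := by
  funext k
  fin_cases k <;> simp

lemma map_tangentPoly (ψ : R →ₐ[K] A) (M : Matrix (Fin 4) (Fin 4) K) (x : Fin 4 → R) :
    (tangentPoly f M x).map (ψ : R →+* A) = tangentPoly f M (fun i => ψ (x i)) := by
  have := map_tangentForm_cubicPoint (Polynomial.mapAlgHom ψ) f M ![1, Polynomial.X]
    (fun i => Polynomial.C (x i))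
  rw [mapAlgHom_comp_dehomog] at this
  simpa [tangentPoly] using this

lemma map_hessianPoly (ψ : R →ₐ[K] A) (M : Matrix (Fin 4) (Fin 4) K) (x : Fin 4 → R) :
    (hessianPoly f M x).map (ψ : R →+* A) = hessianPoly f M (fun i => ψ (x i)) := by
  have := map_hessianForm_cubicPoint (Polynomial.mapAlgHom ψ) f M ![1, Polynomial.X]
    (fun i => Polynomial.C (x i))
  rw [mapAlgHom_comp_dehomog] at this
  simpa [hessianPoly] using this

lemma aeval_zForm (f : MvPolynomial (Fin 4) K) (M : Matrix (Fin 4) (Fin 4) K) (x : Fin 4 → A) :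
    aeval x (zForm f M) =
      Polynomial.resultant (tangentPoly f M x) (hessianPoly f M x) 12 9 := by
  have h := Polynomial.resultant_map_map (tangentPoly f M (X : Fin 4 → MvPolynomial (Fin 4) K))
    (hessianPoly f M X) 12 9 ((aeval x : MvPolynomial (Fin 4) K →ₐ[K] A) : _ →+* A)
  rw [map_tangentPoly, map_hessianPoly] at h
  have e : (fun i => aeval x (X i : MvPolynomial (Fin 4) K)) = x := by
    funext i
    exact aeval_X (R := K) x i
  rw [e, RingHom.coe_coe] at h
  rw [h, zForm, tangentPoly, hessianPoly]

lemma tangentForm_smul {k : Type*} [Field k] [Algebra K k] (hf : f.IsHomogeneous 5)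
    (M : Matrix (Fin 4) (Fin 4) K) (x : Fin 4 → k) (c : k) (u : Fin 2 → k) :
    tangentForm f (cubicPoint M (c • u)) x = c ^ 12 * tangentForm f (cubicPoint M u) x := by
  have h := fun v : Fin 2 → k => homEval_tangentPoly hf M x v
  simp only [Algebra.algebraMap_self, RingHom.id_apply] at h
  rw [← h, ← h, homEval, homEval, Finset.mul_sum]
  refine Finset.sum_congr rfl fun j hj => ?_
  have : 12 = (12 - j) + j := by have := Finset.mem_range.mp hj; omega
  conv_rhs => rw [this, pow_add, ← this]
  simp [mul_pow]
  ring

lemma hessianForm_smul {k : Type*} [Field k] [Algebra K k] (hf : f.IsHomogeneous 5)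
    (M : Matrix (Fin 4) (Fin 4) K) (x : Fin 4 → k) (c : k) (u : Fin 2 → k) :
    hessianForm f (cubicPoint M (c • u)) x = c ^ 9 * hessianForm f (cubicPoint M u) x := by
  have h := fun v : Fin 2 → k => homEval_hessianPoly hf M x v
  simp only [Algebra.algebraMap_self, RingHom.id_apply] at h
  rw [← h, ← h, homEval, homEval, Finset.mul_sum]
  refine Finset.sum_congr rfl fun j hj => ?_
  have : 9 = (9 - j) + j := by have := Finset.mem_range.mp hj; omega
  conv_rhs => rw [this, pow_add, ← this]
  simp [mul_pow]
  ring

/-- Over an algebraically closed extension, the zeros of `zForm` are the points lying on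
`T_P ∩ V_P` for a point `P` of the twisted cubic, given by a normalized parameter. -/
lemma aeval_zForm_eq_zero_iff {k : Type*} [Field k] [IsAlgClosed k] [Algebra K k]
    (hf : f.IsHomogeneous 5) (M : Matrix (Fin 4) (Fin 4) K) (x : Fin 4 → k) :
    aeval x (zForm f M) = 0 ↔ ∃ u : Fin 2 → k, ((∃ t, u = ![1, t]) ∨ u = ![0, 1]) ∧
      tangentForm f (cubicPoint M u) x = 0 ∧ hessianForm f (cubicPoint M u) x = 0 := by
  have hT := fun v : Fin 2 → k => homEval_tangentPoly hf M x v
  have hH := fun v : Fin 2 → k => homEval_hessianPoly hf M x v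
  simp only [Algebra.algebraMap_self, RingHom.id_apply] at hT hH
  have dT := natDegree_tangentPoly_le hf M x
  have dH := natDegree_hessianPoly_le hf M x
  rw [aeval_zForm, resultant_eq_zero_iff_exists_root (by norm_num) (by norm_num) dT dH]
  constructor
  · rintro (⟨t, h1, h2⟩ | ⟨h1, h2⟩)
    · exact ⟨_, Or.inl ⟨t, rfl⟩, by rw [← hT, homEval_one_right _ _ dT, h1],
        by rw [← hH, homEval_one_right _ _ dH, h2]⟩
    · exact ⟨_, Or.inr rfl, by rw [← hT, homEval_zero_one, h1],
        by rw [← hH, homEval_zero_one, h2]⟩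
  · rintro ⟨u, ⟨t, rfl⟩ | rfl, h1, h2⟩
    · left
      exact ⟨t, by rw [← homEval_one_right _ _ dT, hT, h1],
        by rw [← homEval_one_right _ _ dH, hH, h2]⟩
    · right
      exact ⟨by rw [← homEval_zero_one, hT, h1], by rw [← homEval_zero_one, hH, h2]⟩

lemma zeros_zForm_eq_zLocus [IsAlgClosed K] (hf : f.IsHomogeneous 5)
    (M : Matrix (Fin 4) (Fin 4) K) :
    {x : Fin 4 → K | eval x (zForm f M) = 0} = zLocus f M := by
  ext x
  rw [Set.mem_ofPred_eq, ← coe_aeval_eq_eval, zLocus, Set.mem_ofPred_eq]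
  erw [aeval_zForm_eq_zero_iff hf M x]
  constructor
  · rintro ⟨u, hu, h⟩
    refine ⟨u, ?_, h⟩
    rintro rfl
    rcases hu with ⟨t, ht⟩ | ht
    · simpa using congrFun ht 0
    · simpa using congrFun ht 1
  · rintro ⟨u, hu, h1, h2⟩
    -- Rescaling `u` multiplies the two forms by `c ^ 12` and `c ^ 9`, so a parameter may be
    -- normalized to `[1, t]` or `[0, 1]`.
    by_cases h0 : u 0 = 0
    · have hu1 : u 1 ≠ 0 := by
        intro h
        apply hu
        funext k
        fin_cases k <;> simp [h0, h]
      refine ⟨(u 1)⁻¹ • u, Or.inr ?_, ?_, ?_⟩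
      · funext k
        fin_cases k <;> simp [h0, hu1]
      · rw [tangentForm_smul hf, h1, mul_zero]
      · rw [hessianForm_smul hf, h2, mul_zero]
    · refine ⟨(u 0)⁻¹ • u, Or.inl ⟨(u 0)⁻¹ * u 1, ?_⟩, ?_, ?_⟩
      · funext k
        fin_cases k <;> simp [h0]
      · rw [tangentForm_smul hf, h1, mul_zero]
      · rw [hessianForm_smul hf, h2, mul_zero]

end Forms

/-! ### The degree of `zForm`. -/

lemma det_isHomogeneous {σ R n : Type*} [CommRing R] [Fintype n] [DecidableEq n]
    (A : Matrix n n (MvPolynomial σ R)) (d : n → ℕ) (h : ∀ i j, (A i j).IsHomogeneous (d j)) :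
    A.det.IsHomogeneous (∑ j, d j) := by
  rw [Matrix.det_apply']
  refine IsHomogeneous.sum _ _ _ fun g _ => ?_
  have h1 : (∏ i, A (g i) i).IsHomogeneous (∑ j, d j) :=
    IsHomogeneous.prod _ _ _ fun i _ => h _ _
  have h2 : (((Equiv.Perm.sign g : ℤ) : MvPolynomial σ R)).IsHomogeneous 0 := by
    have := isHomogeneous_C σ (((Equiv.Perm.sign g : ℤ) : R))
    simpa using this
  simpa using h2.mul h1

/-- Every Leibniz term takes one entry from each column: 12 columns hold Hessian coefficients,
quadratic in `x`, and 9 hold tangent coefficients, linear in `x`, and 12 · 2 + 9 · 1 = 33. -/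
lemma zForm_isHomogeneous {K : Type*} [Field K] (f : MvPolynomial (Fin 4) K)
    (M : Matrix (Fin 4) (Fin 4) K) : (zForm f M).IsHomogeneous 33 := by
  have key : ∀ h : MvPolynomial (Fin 4) K, ∀ k,
      ((aeval (cubicPoint M ![1, (Polynomial.X : Polynomial (MvPolynomial (Fin 4) K))]) h).coeff
        k).IsHomogeneous 0 := by
    intro h k
    have := map_aeval_comp (Polynomial.mapAlgHom (Algebra.ofId K (MvPolynomial (Fin 4) K))) h
      (cubicPoint M ![1, (Polynomial.X : Polynomial K)])
    rw [map_cubicPoint] at this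
    rw [mapAlgHom_comp_dehomog] at this
    rw [← this]
    simp only [Polynomial.coe_mapAlgHom, Polynomial.coeff_map]
    exact isHomogeneous_C _ _
  have hT : ∀ k, ((tangentPoly f M (X : Fin 4 → MvPolynomial (Fin 4) K)).coeff
      k).IsHomogeneous 1 := by
    intro k
    rw [tangentPoly_eq, Polynomial.finsetSum_coeff]
    refine IsHomogeneous.sum _ _ _ fun i _ => ?_
    rw [Polynomial.coeff_C_mul]
    exact (isHomogeneous_X K i).mul (key _ _)
  have hH : ∀ k, ((hessianPoly f M (X : Fin 4 → MvPolynomial (Fin 4) K)).coeff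
      k).IsHomogeneous 2 := by
    intro k
    rw [hessianPoly_eq, Polynomial.finsetSum_coeff]
    refine IsHomogeneous.sum _ _ _ fun i _ => ?_
    rw [Polynomial.finsetSum_coeff]
    refine IsHomogeneous.sum _ _ _ fun j _ => ?_
    rw [Polynomial.coeff_C_mul]
    exact (((isHomogeneous_C _ (1 / 2 : K)).mul
      ((isHomogeneous_X K i).mul (isHomogeneous_X K j)))).mul (key _ _)
  have h := det_isHomogeneous (Polynomial.sylvester
    (tangentPoly f M (X : Fin 4 → MvPolynomial (Fin 4) K)) (hessianPoly f M X) 12 9)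
    (fun j : Fin (12 + 9) => Fin.addCases (m := 12) (n := 9) (fun _ => 2) (fun _ => 1) j) ?_
  · have e : (∑ j : Fin (12 + 9), Fin.addCases (m := 12) (n := 9) (motive := fun _ => ℕ)
      (fun _ => 2) (fun _ => 1) j) = 33 := by
      rw [Fin.sum_univ_add]
      simp
    rw [e] at h
    exact h
  · intro i j
    induction j using Fin.addCases with
    | left j =>
      simp only [Polynomial.sylvester, Matrix.of_apply, Fin.addCases_left]
      split_ifs
      · exact hH _
      · exact isHomogeneous_zero _ _ _
    | right j =>
      simp only [Polynomial.sylvester, Matrix.of_apply, Fin.addCases_right]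
      split_ifs
      · exact hT _
      · exact isHomogeneous_zero _ _ _

/-! ### Determinants lying in the square of an ideal. -/

section DeterminantInSquare

/-- Each Leibniz term contains a factor from row `i` and another from row `j`. -/
lemma det_mem_sq_of_rows {n S : Type*} [Fintype n] [DecidableEq n] [CommRing S] (I : Ideal S)
    (A : Matrix n n S) {i j : n} (hij : i ≠ j) (hi : ∀ c, A i c ∈ I) (hj : ∀ c, A j c ∈ I) :
    A.det ∈ I ^ 2 := by
  rw [← Matrix.det_transpose, Matrix.det_apply]
  refine Ideal.sum_mem _ fun g _ => Submodule.smul_of_tower_mem _ _ ?_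
  simp only [Matrix.transpose_apply]
  rw [← Finset.mul_prod_erase _ _ (Finset.mem_univ i),
    ← Finset.mul_prod_erase _ _ (Finset.mem_erase.mpr ⟨hij.symm, Finset.mem_univ j⟩), ← mul_assoc,
    pow_two]
  exact Ideal.mul_mem_right _ _ (Ideal.mul_mem_mul (hi _) (hj _))

/-- If two linearly independent constant combinations of the rows of a matrix have entries in an
ideal, then its determinant lies in the square of the ideal. -/
lemma det_mem_sq_of_linearIndependent {n K S : Type*} [Fintype n] [DecidableEq n] [Field K]
    [CommRing S] [Algebra K S] (I : Ideal S) (A : Matrix n n S) {v w : n → K}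
    (hvw : LinearIndependent K ![v, w])
    (hv : ∀ c, ∑ i, algebraMap K S (v i) * A i c ∈ I)
    (hw : ∀ c, ∑ i, algebraMap K S (w i) * A i c ∈ I) : A.det ∈ I ^ 2 := by
  rw [LinearIndependent.pair_iff] at hvw
  obtain ⟨i, hi⟩ : ∃ i, v i ≠ 0 := by
    by_contra! h
    have := hvw 1 0 (by ext k; simp [h k])
    simp at this
  -- Eliminating entry `i` makes the second row operation independent of the already replaced row
  -- `i`.
  set z : n → K := v i • w - w i • v with hz
  have hzi : z i = 0 := by simp [hz, mul_comm]
  obtain ⟨j, hj⟩ : ∃ j, z j ≠ 0 := by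
    by_contra! h
    have := hvw (-w i) (v i) (by
      ext k
      have := h k
      simp only [hz, Pi.sub_apply, Pi.smul_apply, smul_eq_mul] at this
      simp only [Pi.add_apply, Pi.smul_apply, smul_eq_mul, Pi.zero_apply]
      linear_combination this)
    exact hi this.2
  have hij : i ≠ j := by rintro rfl; exact hj hzi
  set A₁ := A.updateRow i (∑ k, algebraMap K S (v k) • A k) with hA₁
  have h1 : A₁.det = algebraMap K S (v i) • A.det :=
    Matrix.det_updateRow_sum A i fun k => algebraMap K S (v k)
  set A₂ := A₁.updateRow j (∑ k, algebraMap K S (z k) • A₁ k) with hA₂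
  have h2 : A₂.det = algebraMap K S (z j) • A₁.det :=
    Matrix.det_updateRow_sum A₁ j fun k => algebraMap K S (z k)
  have h3 : A₂.det ∈ I ^ 2 := by
    refine det_mem_sq_of_rows I A₂ hij (fun c => ?_) (fun c => ?_)
    · rw [hA₂, Matrix.updateRow_ne hij, hA₁, Matrix.updateRow_self]
      simpa [Algebra.smul_def] using hv c
    · rw [hA₂, Matrix.updateRow_self]
      have : (∑ k, algebraMap K S (z k) • A₁ k) c =
          algebraMap K S (v i) * (∑ k, algebraMap K S (w k) * A k c) -
            algebraMap K S (w i) * (∑ k, algebraMap K S (v k) * A k c) := by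
        rw [Finset.mul_sum, Finset.mul_sum, ← Finset.sum_sub_distrib, Finset.sum_apply]
        refine Finset.sum_congr rfl fun k _ => ?_
        by_cases hk : k = i
        · subst hk
          rw [hzi]
          simp
          ring
        · rw [hA₁, Matrix.updateRow_ne hk]
          simp [hz]
          ring
      rw [this]
      exact I.sub_mem (I.mul_mem_left _ (hw c)) (I.mul_mem_left _ (hv c))
  rw [h2, h1, smul_eq_mul, smul_eq_mul, ← mul_assoc, ← map_mul] at h3
  have hu : IsUnit (algebraMap K S (z j * v i)) :=
    (IsUnit.mk0 _ (mul_ne_zero hj hi)).map _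
  exact (Ideal.unit_mul_mem_iff_mem _ hu).mp h3

end DeterminantInSquare

/-! ### Chain rule and directional derivatives along a linear subspace. -/

section DirectionalDerivatives

/-- The chain rule for a derivation applied to a polynomial expression. -/
lemma derivation_aeval {σ K A : Type*} [Fintype σ] [CommRing K] [CommRing A] [Algebra K A]
    (D : Derivation K A A) (x : σ → A) (h : MvPolynomial σ K) :
    D (aeval x h) = ∑ i, aeval x (pderiv i h) * D (x i) := by
  classical
  induction h using MvPolynomial.induction_on with
  | C a => simp [← algebraMap_eq]
  | add p q hp hq => simp [hp, hq, add_mul, Finset.sum_add_distrib]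
  | mul_X p j hp =>
    simp only [map_mul, aeval_X, Derivation.leibniz, hp, smul_eq_mul, pderiv_X, map_add, add_mul,
      Finset.sum_add_distrib, Finset.mul_sum]
    congr 1
    · rw [Finset.sum_eq_single j]
      · simp
      · intro b _ hb
        simp [hb]
      · simp
    · refine Finset.sum_congr rfl fun i _ => ?_
      ring

variable {K : Type*} [Field K]

lemma eval_eq_aeval {σ : Type*} (x : σ → K) (h : MvPolynomial σ K) : eval x h = aeval x h :=
  (RingHom.congr_fun (coe_aeval_eq_eval x) h).symm

/-- The restriction of `h` to the line is the zero polynomial in `t`, the field being infinite, and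
the sum is its derivative at `t = 0`. -/
lemma sum_pderiv_mul_eq_zero [Infinite K] {σ : Type*} [Fintype σ] (h : MvPolynomial σ K)
    (p x : σ → K) (hp : ∀ t : K, eval (p + t • x) h = 0) :
    ∑ i, eval p (pderiv i h) * x i = 0 := by
  set γ : σ → Polynomial K := fun i => Polynomial.C (p i) + Polynomial.X * Polynomial.C (x i)
    with hγ
  have key : ∀ (t : K) (g : MvPolynomial σ K), (aeval γ g).eval t = eval (p + t • x) g := by
    intro t g
    rw [← Polynomial.coe_aeval_eq_eval, map_aeval_comp (Polynomial.aeval t), eval_eq_aeval]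
    congr 2
    funext i
    simp only [hγ, map_add, map_mul, Polynomial.aeval_C, Polynomial.aeval_X, Pi.add_apply,
      Pi.smul_apply, smul_eq_mul, Algebra.algebraMap_self, RingHom.id_apply]
  have h0 : aeval γ h = 0 := Polynomial.funext fun t => by rw [key, hp]; simp
  have h1 := derivation_aeval (Polynomial.derivative') γ h
  rw [h0, map_zero] at h1
  have h2 := congrArg (Polynomial.eval 0) h1
  simp only [Polynomial.eval_finsetSum, Polynomial.eval_mul, key] at h2
  simpa [hγ, Polynomial.derivative'] using h2.symm

variable (L : Submodule K (Fin 4 → K))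

lemma sum_pderiv_mul_eq_zero_of_mem [Infinite K] {h : MvPolynomial (Fin 4) K}
    (hh : ∀ x ∈ L, eval x h = 0) {p x : Fin 4 → K} (hp : p ∈ L) (hx : x ∈ L) :
    ∑ i, eval p (pderiv i h) * x i = 0 :=
  sum_pderiv_mul_eq_zero h p x fun t => hh _ (L.add_mem hp (L.smul_mem t hx))

/-- The tangent form at a variable point, in a fixed direction. -/
noncomputable def tangentDir (f : MvPolynomial (Fin 4) K) (x : Fin 4 → K) :
    MvPolynomial (Fin 4) K := ∑ i, pderiv i f * C (x i)

/-- The Hessian form at a variable point, in a fixed direction. -/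
noncomputable def hessianDir (f : MvPolynomial (Fin 4) K) (x : Fin 4 → K) :
    MvPolynomial (Fin 4) K := C (1 / 2) * ∑ i, ∑ j, C (x i) * pderiv i (pderiv j f) * C (x j)

lemma tangentForm_eq_aeval {A : Type*} [CommRing A] [Algebra K A] (f : MvPolynomial (Fin 4) K)
    (p : Fin 4 → A) (x : Fin 4 → K) :
    tangentForm f p (fun i => algebraMap K A (x i)) = aeval p (tangentDir f x) := by
  simp [tangentForm, tangentDir]

lemma hessianForm_eq_aeval {A : Type*} [CommRing A] [Algebra K A] (f : MvPolynomial (Fin 4) K)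
    (p : Fin 4 → A) (x : Fin 4 → K) :
    hessianForm f p (fun i => algebraMap K A (x i)) = aeval p (hessianDir f x) := by
  simp only [hessianForm, hessianDir, map_mul, map_sum, aeval_C]

lemma eval_tangentDir_eq_zero [Infinite K] {f : MvPolynomial (Fin 4) K}
    (hf : ∀ x ∈ L, eval x f = 0) {x : Fin 4 → K} (hx : x ∈ L) :
    ∀ p ∈ L, eval p (tangentDir f x) = 0 := by
  intro p hp
  simpa [tangentDir] using sum_pderiv_mul_eq_zero_of_mem L hf hp hx

/-- `tangentDir f x` again vanishes on `L`, so it can be differentiated once more in the direction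
`x`, which yields twice the Hessian form. -/
lemma eval_hessianDir_eq_zero [Infinite K] {f : MvPolynomial (Fin 4) K}
    (hf : ∀ x ∈ L, eval x f = 0) {x : Fin 4 → K} (hx : x ∈ L) :
    ∀ p ∈ L, eval p (hessianDir f x) = 0 := by
  intro p hp
  have h := sum_pderiv_mul_eq_zero_of_mem L (eval_tangentDir_eq_zero L hf hx) hp hx
  have h2 : ∑ i, ∑ j, x i * eval p (pderiv i (pderiv j f)) * x j = 0 := by
    rw [← h]
    refine Finset.sum_congr rfl fun i _ => ?_
    rw [tangentDir, map_sum, map_sum, Finset.sum_mul]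
    refine Finset.sum_congr rfl fun j _ => ?_
    simp
    ring
  rw [hessianDir, map_mul]
  simp only [map_sum, map_mul, eval_C]
  rw [h2, mul_zero]

end DirectionalDerivatives

/-! ### `zForm` lies in the square of the ideal of the line. -/

section DoubleRoot

variable {K : Type*} [Field K]

/-- `zForm` is the determinant of the Sylvester matrix over `K[x₁, …, x₄]`. -/
lemma zForm_eq_det (f : MvPolynomial (Fin 4) K) (M : Matrix (Fin 4) (Fin 4) K) :
    zForm f M = (Polynomial.sylvester (tangentPoly f M (X : Fin 4 → MvPolynomial (Fin 4) K))
      (hessianPoly f M X) 12 9).det := by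
  rw [zForm, tangentPoly, hessianPoly, Polynomial.resultant]

lemma aeval_sylvester (f : MvPolynomial (Fin 4) K) (M : Matrix (Fin 4) (Fin 4) K)
    (x : Fin 4 → K) (i j : Fin (12 + 9)) :
    aeval x (Polynomial.sylvester (tangentPoly f M (X : Fin 4 → MvPolynomial (Fin 4) K))
      (hessianPoly f M X) 12 9 i j) =
      Polynomial.sylvester (tangentPoly f M x) (hessianPoly f M x) 12 9 i j := by
  have h := Polynomial.sylvester_map_map (tangentPoly f M (X : Fin 4 → MvPolynomial (Fin 4) K))
    (hessianPoly f M X) 12 9 ((aeval x : MvPolynomial (Fin 4) K →ₐ[K] K) : _ →+* K)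
  rw [map_tangentPoly, map_hessianPoly] at h
  have e : (fun i => aeval x (X i : MvPolynomial (Fin 4) K)) = x := by
    funext i
    exact aeval_X (R := K) x i
  rw [e] at h
  exact (congrFun (congrFun h i) j).symm

/-- The Sylvester matrix of the tangent and Hessian forms in direction `x`, paired with the
monomials in generic parameters, in terms of the forms along the twisted cubic. -/
lemma sum_X_mul_sylvester {f : MvPolynomial (Fin 4) K} (hf : f.IsHomogeneous 5)
    (M : Matrix (Fin 4) (Fin 4) K) (x : Fin 4 → K) (c : Fin (12 + 9)) :
    ∃ a b : MvPolynomial (Fin 2) K,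
      ∑ i : Fin (12 + 9), (X 0 : MvPolynomial (Fin 2) K) ^ (12 + 9 - 1 - (i : ℕ)) *
        X 1 ^ (i : ℕ) *
        C (Polynomial.sylvester (tangentPoly f M x) (hessianPoly f M x) 12 9 i c) =
      a * aeval (cubicPoint M X) (tangentDir f x) +
        b * aeval (cubicPoint M X) (hessianDir f x) := by
  have h := sum_monomial_mul_sylvester 12 9 (tangentPoly f M x) (hessianPoly f M x)
    (X : Fin 2 → MvPolynomial (Fin 2) K) c
  rw [homEval_tangentPoly hf, homEval_hessianPoly hf, tangentForm_eq_aeval,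
    hessianForm_eq_aeval] at h
  induction c using Fin.addCases with
  | left j =>
    rw [Fin.addCases_left] at h
    refine ⟨0, X 0 ^ (12 - 1 - (j : ℕ)) * X 1 ^ (j : ℕ), h.trans ?_⟩
    ring
  | right j =>
    rw [Fin.addCases_right] at h
    refine ⟨X 0 ^ (9 - 1 - (j : ℕ)) * X 1 ^ (j : ℕ), 0, h.trans ?_⟩
    ring

variable (L : Submodule K (Fin 4 → K))

lemma zForm_mem_sq [Infinite K] {f : MvPolynomial (Fin 4) K} (M : Matrix (Fin 4) (Fin 4) K)
    {v w : Fin (12 + 9) → K} (hvw : LinearIndependent K ![v, w])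
    (hv : ∀ x ∈ L, ∀ c, ∑ i, v i *
      Polynomial.sylvester (tangentPoly f M x) (hessianPoly f M x) 12 9 i c = 0)
    (hw : ∀ x ∈ L, ∀ c, ∑ i, w i *
      Polynomial.sylvester (tangentPoly f M x) (hessianPoly f M x) 12 9 i c = 0) :
    zForm f M ∈ vanishingIdeal K (L : Set (Fin 4 → K)) ^ 2 := by
  rw [zForm_eq_det]
  refine det_mem_sq_of_linearIndependent _ _ hvw (fun c => ?_) (fun c => ?_)
  · rw [mem_vanishingIdeal_iff]
    intro x hx
    rw [map_sum, ← hv x hx c]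
    refine Finset.sum_congr rfl fun i _ => ?_
    rw [map_mul, aeval_sylvester, AlgHom.commutes, Algebra.algebraMap_self_apply]
  · rw [mem_vanishingIdeal_iff]
    intro x hx
    rw [map_sum, ← hw x hx c]
    refine Finset.sum_congr rfl fun i _ => ?_
    rw [map_mul, aeval_sylvester, AlgHom.commutes, Algebra.algebraMap_self_apply]

/-- The two row combinations are the monomial vectors at `u` and `v`, which are independent because
the parameters are distinct points of the projective line. -/
lemma zForm_mem_sq_of_secant [Infinite K] {f : MvPolynomial (Fin 4) K} (hf : f.IsHomogeneous 5)
    (M : Matrix (Fin 4) (Fin 4) K) (hLf : ∀ x ∈ L, eval x f = 0) {u v : Fin 2 → K}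
    (huv : LinearIndependent K ![u, v]) (hu : cubicPoint M u ∈ L) (hv : cubicPoint M v ∈ L) :
    zForm f M ∈ vanishingIdeal K (L : Set (Fin 4 → K)) ^ 2 := by
  have key : ∀ u : Fin 2 → K, cubicPoint M u ∈ L → ∀ x ∈ L, ∀ c,
      ∑ i : Fin (12 + 9), u 0 ^ (12 + 9 - 1 - (i : ℕ)) * u 1 ^ (i : ℕ) *
      Polynomial.sylvester (tangentPoly f M x) (hessianPoly f M x) 12 9 i c = 0 := by
    intro u hu x hx c
    obtain ⟨a, b, h⟩ := sum_X_mul_sylvester hf M x c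
    have h' := congrArg (aeval u : MvPolynomial (Fin 2) K →ₐ[K] K) h
    rw [map_add, map_mul, map_mul, aeval_aeval_cubicPoint_X, aeval_aeval_cubicPoint_X,
      ← eval_eq_aeval (cubicPoint M u), ← eval_eq_aeval (cubicPoint M u),
      eval_tangentDir_eq_zero L hLf hx _ hu, eval_hessianDir_eq_zero L hLf hx _ hu] at h'
    simpa using h'
  refine zForm_mem_sq L M (v := fun i => u 0 ^ (12 + 9 - 1 - (i : ℕ)) * u 1 ^ (i : ℕ))
    (w := fun i => v 0 ^ (12 + 9 - 1 - (i : ℕ)) * v 1 ^ (i : ℕ)) ?_ (key u hu) (key v hv)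
  have hdet : u 0 * v 1 - u 1 * v 0 ≠ 0 := by
    intro h
    rw [LinearIndependent.pair_iff] at huv
    have h1 := huv (v 1) (-u 1) (by
      ext k
      fin_cases k
      · simp; linear_combination h
      · simp; ring)
    have h2 := huv (v 0) (-u 0) (by
      ext k
      fin_cases k
      · simp; ring
      · simp; linear_combination -h)
    have h3 := huv 0 1 (by
      ext k
      fin_cases k <;> simp [h1.1, h2.1])
    simp at h3
  rw [LinearIndependent.pair_iff]
  intro a b hab
  -- The monomials `s^20`, `s^19 t` and `t^20` already detect independence.
  have e0 := congrFun hab ⟨0, by norm_num⟩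
  have e1 := congrFun hab ⟨1, by norm_num⟩
  have e20 := congrFun hab ⟨20, by norm_num⟩
  simp only [Pi.add_apply, Pi.smul_apply, smul_eq_mul, Pi.zero_apply, pow_zero, mul_one, pow_one,
    Nat.reduceAdd, Nat.reduceSub] at e0 e1 e20
  norm_num at e0 e1 e20
  by_cases hu0 : u 0 = 0
  · have hv0 : v 0 ≠ 0 := by intro h; apply hdet; rw [hu0, h]; ring
    have hu1 : u 1 ≠ 0 := by intro h; apply hdet; rw [hu0, h]; ring
    have hb : b = 0 := by simpa [hu0, hv0] using e0
    refine ⟨?_, hb⟩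
    simpa [hb, hu1] using e20
  · by_cases hv0 : v 0 = 0
    · have hv1 : v 1 ≠ 0 := by intro h; apply hdet; rw [hv0, h]; ring
      have ha : a = 0 := by simpa [hu0, hv0] using e0
      refine ⟨ha, ?_⟩
      simpa [ha, hv1] using e20
    · have hb : b * (v 0 ^ 19 * (u 0 * v 1 - u 1 * v 0)) = 0 := by
        linear_combination u 0 * e1 - u 1 * e0
      have hb' : b = 0 := by simpa [hv0, hdet] using hb
      refine ⟨?_, hb'⟩
      simpa [hb', hu0] using e0

/-- The forms along the cubic in a direction of `L` vanish at `u` with both partial derivatives, and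
by the Leibniz rule so do their multiples given by the Sylvester columns. The row combinations are
therefore the two partial derivatives of the monomial vector at `u`. -/
lemma zForm_mem_sq_of_tangent [CharZero K] {f : MvPolynomial (Fin 4) K}
    (hf : f.IsHomogeneous 5) (M : Matrix (Fin 4) (Fin 4) K) {u : Fin 2 → K} (hu : u ≠ 0)
    (hLf : ∀ x ∈ cubicTangentLine M u, eval x f = 0) :
    zForm f M ∈ vanishingIdeal K (cubicTangentLine M u : Set (Fin 4 → K)) ^ 2 := by
  set L := cubicTangentLine M u with hL
  set φ : Fin 4 → MvPolynomial (Fin 2) K := cubicPoint M X with hφ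
  have hd : ∀ k : Fin 2, (fun i => eval u (pderiv k (φ i))) ∈ L := fun k =>
    Submodule.subset_span ⟨k, rfl⟩
  have hφu : (fun i => eval u (φ i)) = cubicPoint M u := by
    have := map_cubicPoint (aeval u) M (X : Fin 2 → MvPolynomial (Fin 2) K)
    simp only [aeval_X] at this
    rw [← this]
    funext i
    rw [eval_eq_aeval]
  have hp : cubicPoint M u ∈ L := by
    -- Euler's relation for the cubic parametrization puts the point itself on the tangent line.
    have h3 : (3 : K) • cubicPoint M u = u 0 • (fun i => eval u (pderiv 0 (φ i))) +
        u 1 • (fun i => eval u (pderiv 1 (φ i))) := by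
      rw [← hφu]
      funext i
      have := congrArg (eval u) (cubicPoint_X_isHomogeneous M i).sum_X_mul_pderiv
      rw [Fin.sum_univ_two] at this
      simpa [hφ] using this.symm
    have h3' : (3 : K) • cubicPoint M u ∈ L := by
      rw [h3]
      exact L.add_mem (L.smul_mem _ (hd 0)) (L.smul_mem _ (hd 1))
    exact (L.smul_mem_iff (by norm_num)).mp h3'
  have hder : ∀ h : MvPolynomial (Fin 4) K, (∀ x ∈ L, eval x h = 0) → ∀ k,
      eval u (pderiv k (aeval φ h)) = 0 := by
    intro h hh k
    rw [derivation_aeval (pderiv k) φ h, map_sum]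
    rw [← sum_pderiv_mul_eq_zero_of_mem L hh hp (hd k)]
    refine Finset.sum_congr rfl fun i _ => ?_
    rw [map_mul, eval_eq_aeval u (aeval φ (pderiv i h)), aeval_aeval_cubicPoint_X,
      eval_eq_aeval (cubicPoint M u)]
  have hval : ∀ h : MvPolynomial (Fin 4) K, (∀ x ∈ L, eval x h = 0) →
      eval u (aeval φ h) = 0 := by
    intro h hh
    rw [eval_eq_aeval u (aeval φ h), aeval_aeval_cubicPoint_X, ← eval_eq_aeval (cubicPoint M u)]
    exact hh _ hp
  have key : ∀ k : Fin 2, ∀ x ∈ L, ∀ c,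
      ∑ i : Fin (12 + 9), eval u (pderiv k
        ((X 0 : MvPolynomial (Fin 2) K) ^ (12 + 9 - 1 - (i : ℕ)) * X 1 ^ (i : ℕ))) *
      Polynomial.sylvester (tangentPoly f M x) (hessianPoly f M x) 12 9 i c = 0 := by
    intro k x hx c
    obtain ⟨a, b, h⟩ := sum_X_mul_sylvester hf M x c
    have h' := congrArg (fun g => eval u (pderiv k g)) h
    simp only [map_add, Derivation.leibniz (pderiv k) a, Derivation.leibniz (pderiv k) b,
      smul_eq_mul, map_mul] at h'
    rw [hder _ (eval_tangentDir_eq_zero L hLf hx), hder _ (eval_hessianDir_eq_zero L hLf hx),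
      hval _ (eval_tangentDir_eq_zero L hLf hx), hval _ (eval_hessianDir_eq_zero L hLf hx)] at h'
    simp only [mul_zero, zero_mul, add_zero] at h'
    rw [← h', map_sum, map_sum]
    refine Finset.sum_congr rfl fun i _ => ?_
    rw [Derivation.leibniz _ _ (C _), pderiv_C]
    simp
    ring
  refine zForm_mem_sq L M ?_ (key 0) (key 1)
  rw [LinearIndependent.pair_iff]
  intro a b hab
  -- Two monomials at one end suffice: `s^20`, `s^19 t` if `u 0 ≠ 0`, and `s t^19`, `t^20`
  -- otherwise. The factor 20 is nonzero in characteristic zero.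
  have e0 := congrFun hab ⟨0, by norm_num⟩
  have e1 := congrFun hab ⟨1, by norm_num⟩
  have e19 := congrFun hab ⟨19, by norm_num⟩
  have e20 := congrFun hab ⟨20, by norm_num⟩
  simp [pderiv_X, Derivation.leibniz_pow] at e0 e1 e19 e20
  by_cases hu0 : u 0 = 0
  · have hu1 : u 1 ≠ 0 := by
      intro h
      apply hu
      funext k
      fin_cases k <;> simp [hu0, h]
    simp [hu0, hu1] at e19 e20
    exact ⟨e19, e20⟩
  · simp [hu0] at e0
    simp [hu0, e0] at e1
    exact ⟨e0, e1⟩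

end DoubleRoot

/-! ### From membership in the squared ideal to length at least two. -/

section Multiplicity

/-- A quotient of a local ring by an ideal strictly inside the maximal ideal has length at least
two. -/
lemma two_le_length_quotient {S : Type*} [CommRing S] [IsLocalRing S] {I J : Ideal S}
    (hIJ : I ≤ J) (hJ : J ≤ IsLocalRing.maximalIdeal S) (hne : ¬ IsLocalRing.maximalIdeal S ≤ J) :
    2 ≤ Module.length S (S ⧸ I) := by
  have h1 : Module.length S (S ⧸ J) ≤ Module.length S (S ⧸ I) :=
    Module.length_le_of_surjective (Submodule.factor hIJ) (Submodule.factor_surjective hIJ)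
  refine le_trans ?_ h1
  have hJtop : J ≠ ⊤ := fun h => (IsLocalRing.maximalIdeal.isMaximal S).ne_top (top_le_iff.mp (h ▸ hJ))
  have h0 : Module.length S (S ⧸ J) ≠ 0 := by
    rw [Ne, Module.length_eq_zero_iff, Submodule.Quotient.subsingleton_iff]
    exact hJtop
  have h2 : Module.length S (S ⧸ J) ≠ 1 := by
    rw [Ne, Module.length_eq_one_iff, isSimpleModule_iff_isCoatom]
    intro h
    exact hne (IsLocalRing.eq_maximalIdeal ⟨h⟩).ge
  rw [← one_add_one_eq_two]
  refine Order.add_one_le_of_lt (lt_of_le_of_ne ?_ h2.symm)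
  exact Order.one_le_iff_pos.mpr (pos_iff_ne_zero.mpr h0)

variable {K : Type*} [Field K] (L : Submodule K (Fin 4 → K))

lemma exists_linearIndependent_equations (hL : Module.finrank K L = 2) :
    ∃ c d : Fin 4 → K, LinearIndependent K ![c, d] ∧ (∀ x ∈ L, ∑ i, c i * x i = 0) ∧
      ∀ x ∈ L, ∑ i, d i * x i = 0 := by
  let b := Module.finBasisOfFinrankEq K L hL
  let Φ : (Fin 4 → K) →ₗ[K] (Fin 2 → K) :=
    LinearMap.pi fun k => ∑ i, (b k : Fin 4 → K) i • LinearMap.proj i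
  have hΦ : ∀ c k, Φ c k = ∑ i, c i * (b k : Fin 4 → K) i := by
    intro c k
    simp [Φ, mul_comm]
  have h2 : 2 ≤ Module.finrank K (LinearMap.ker Φ) := by
    have h := Φ.finrank_range_add_finrank_ker
    have h' := Submodule.finrank_le (LinearMap.range Φ)
    rw [Module.finrank_fin_fun] at h h'
    omega
  obtain ⟨g, hg⟩ := exists_linearIndependent_of_le_finrank h2
  have hz : ∀ k, ∀ x ∈ L, ∑ i, (g k : Fin 4 → K) i * x i = 0 := by
    intro k x hx
    have hx' := congrArg Subtype.val (b.sum_repr ⟨x, hx⟩)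
    rw [Fin.sum_univ_two] at hx'
    have h0 : ∀ j, ∑ i, (g k : Fin 4 → K) i * (b j : Fin 4 → K) i = 0 := by
      intro j
      rw [← hΦ, (LinearMap.mem_ker.mp (g k).2)]
      rfl
    simp only [Submodule.coe_add, Submodule.coe_smul] at hx'
    have e := congrArg (fun y => (g k : Fin 4 → K) ⬝ᵥ y) hx'
    simp only [dotProduct_add, dotProduct_smul] at e
    simp only [dotProduct, h0, smul_zero, add_zero] at e
    exact e.symm
  refine ⟨g 0, g 1, ?_, hz 0, hz 1⟩
  have hg' := hg.map' (LinearMap.ker Φ).subtype (Submodule.ker_subtype _)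
  have e : ![(g 0 : Fin 4 → K), (g 1 : Fin 4 → K)] = (LinearMap.ker Φ).subtype ∘ g := by
    funext k
    fin_cases k <;> rfl
  rw [e]
  exact hg'

lemma pderiv_mem_of_mem_sq {σ R : Type*} [CommRing R] (I : Ideal (MvPolynomial σ R))
    {r : MvPolynomial σ R} (hr : r ∈ I ^ 2) (i : σ) : pderiv i r ∈ I := by
  rw [pow_two] at hr
  refine Submodule.mul_induction_on hr (fun a ha b hb => ?_) (fun a b ha hb => ?_)
  · rw [Derivation.leibniz]
    exact I.add_mem (I.mul_mem_right _ ha) (I.mul_mem_right _ hb)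
  · rw [map_add]
    exact I.add_mem ha hb

/-- The ideal `(f, R)` lies in `(f) + 𝔭²`. Were this the maximal ideal locally, every gradient of an
element of `𝔭` would be proportional to that of `f` along `L`; but `L` is cut out by two linear
forms with independent constant gradients. -/
lemma two_le_intersectionMult [Infinite K] (hL : Module.finrank K L = 2) {f R : MvPolynomial (Fin 4) K}
    (hf : f ∈ vanishingIdeal K (L : Set (Fin 4 → K)))
    (hR : R ∈ vanishingIdeal K (L : Set (Fin 4 → K)) ^ 2) :
    2 ≤ intersectionMult (vanishingIdeal K (L : Set (Fin 4 → K))) f R := by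
  set 𝔭 := vanishingIdeal K (L : Set (Fin 4 → K)) with h𝔭
  have hmem : ∀ g : MvPolynomial (Fin 4) K, g ∈ 𝔭 ↔ ∀ x ∈ L, eval x g = 0 := by
    intro g
    rw [h𝔭, mem_vanishingIdeal_iff]
    simp only [eval_eq_aeval]
    rfl
  have hle : Ideal.span {f} ⊔ 𝔭 ^ 2 ≤ 𝔭 :=
    sup_le ((Ideal.span_singleton_le_iff_mem _).mpr hf) (Ideal.pow_le_self two_ne_zero)
  have hmax := Localization.AtPrime.map_eq_maximalIdeal (I := 𝔭)
  refine two_le_length_quotient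
    (J := Ideal.map (algebraMap _ (Localization.AtPrime 𝔭)) (Ideal.span {f} ⊔ 𝔭 ^ 2)) ?_ ?_ ?_
  · rw [Ideal.span_le, Set.insert_subset_iff, Set.singleton_subset_iff]
    exact ⟨Ideal.mem_map_of_mem _ (Ideal.mem_sup_left (Ideal.mem_span_singleton_self f)),
      Ideal.mem_map_of_mem _ (Ideal.mem_sup_right hR)⟩
  · rw [← hmax]
    exact Ideal.map_mono hle
  · intro hcon
    rw [← hmax] at hcon
    -- Clearing denominators gives `s h ≡ a f` modulo `𝔭²`. Differentiation on `L` kills the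
    -- derivatives of `s` and `a`, as well as the `𝔭²` part.
    have grad : ∀ h ∈ 𝔭, ∃ s ∉ 𝔭, ∃ a : MvPolynomial (Fin 4) K, ∀ x ∈ L, ∀ i,
        eval x s * eval x (pderiv i h) = eval x a * eval x (pderiv i f) := by
      intro h hh
      have h1 := hcon (Ideal.mem_map_of_mem _ hh)
      rw [IsLocalization.mem_map_algebraMap_iff 𝔭.primeCompl] at h1
      obtain ⟨⟨⟨y, hy⟩, s⟩, h2⟩ := h1
      rw [← map_mul] at h2
      obtain ⟨c, hc⟩ := (IsLocalization.eq_iff_exists 𝔭.primeCompl _).mp h2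
      obtain ⟨y₁, hy₁, r, hr, hyr⟩ := Submodule.mem_sup.mp hy
      obtain ⟨a, rfl⟩ := Ideal.mem_span_singleton'.mp hy₁
      refine ⟨c * s, fun hcs => (c * s).2 hcs, c * a, fun x hx i => ?_⟩
      have h3 := congrArg (fun g => eval x (pderiv i g)) hc
      simp only at hyr h3
      rw [← hyr] at h3
      simp only [Derivation.leibniz, smul_eq_mul, map_add, map_mul, (hmem h).mp hh x hx,
        (hmem f).mp hf x hx, (hmem _).mp (pderiv_mem_of_mem_sq 𝔭 hr i) x hx,
        (hmem r).mp (Ideal.pow_le_self two_ne_zero hr) x hx] at h3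
      rw [map_mul, map_mul]
      linear_combination h3
    obtain ⟨c, d, hcd, hc, hd⟩ := exists_linearIndependent_equations L hL
    have hlin : ∀ c : Fin 4 → K, (∀ x ∈ L, ∑ i, c i * x i = 0) →
        (∑ i, C (c i) * X i : MvPolynomial (Fin 4) K) ∈ 𝔭 := by
      intro c hc
      rw [hmem]
      intro x hx
      simpa using hc x hx
    have hpd : ∀ (c : Fin 4 → K) (x : Fin 4 → K) (i : Fin 4),
        eval x (pderiv i (∑ i, C (c i) * X i : MvPolynomial (Fin 4) K)) = c i := by
      intro c x i
      simp [map_sum, Derivation.leibniz, pderiv_X, Pi.single_apply]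
    obtain ⟨s, hs, a, hsa⟩ := grad _ (hlin c hc)
    obtain ⟨t, ht, b, htb⟩ := grad _ (hlin d hd)
    -- Primality provides one point of `L` where neither denominator vanishes.
    have hst : s * t ∉ 𝔭 := fun h => ((inferInstance : 𝔭.IsPrime).mem_or_mem h).elim hs ht
    rw [hmem] at hst
    push Not at hst
    obtain ⟨x, hx, hxst⟩ := hst
    rw [map_mul] at hxst
    have h1 := hsa x hx
    have h2 := htb x hx
    simp only [hpd] at h1 h2
    rw [LinearIndependent.pair_iff] at hcd
    have h3 := hcd (eval x b * eval x s) (-(eval x a * eval x t)) (by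
      ext i
      simp only [Pi.add_apply, Pi.smul_apply, smul_eq_mul, Pi.zero_apply]
      linear_combination eval x b * h1 i - eval x a * h2 i)
    have ha : eval x a = 0 := by
      have := h3.2
      rw [neg_eq_zero, mul_eq_zero] at this
      exact this.resolve_right (right_ne_zero_of_mul hxst)
    have h4 := hcd (eval x s) 0 (by
      ext i
      have := h1 i
      rw [ha, zero_mul] at this
      simpa using this)
    exact left_ne_zero_of_mul hxst h4.1

end Multiplicity

/-! ### A generic point of the surface and two derivations. -/

section GenericPoint

/-- A derivation extends along a formally étale extension. -/
lemma exists_derivation_extension (R S T : Type*) [CommRing R] [CommRing S] [CommRing T]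
    [Algebra R S] [Algebra R T] [Algebra S T] [IsScalarTower R S T] [Algebra.FormallyEtale S T]
    (D : Derivation R S S) :
    ∃ D' : Derivation R T T, ∀ s, D' (algebraMap S T s) = algebraMap S T (D s) := by
  let g : Ω[S⁄R] →ₗ[S] T := (Algebra.linearMap S T).comp D.liftKaehlerDifferential
  let l : Ω[T⁄R] →ₗ[T] T := (g.liftBaseChange T).comp
    (KaehlerDifferential.tensorKaehlerEquivOfFormallyEtale R S T).symm.toLinearMap
  refine ⟨l.compDer (KaehlerDifferential.D R T), fun s => ?_⟩
  simp [l, g, KaehlerDifferential.tensorKaehlerEquivOfFormallyEtale_symm_D_algebraMap,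
    -KaehlerDifferential.tensorKaehlerEquivOfFormallyEtale_apply]

universe u in
/-- An algebraically closed extension carrying two derivations dual to two elements. -/
lemma exists_algClosed_extension_with_derivations (K : Type u) [Field K] [CharZero K] :
    ∃ (E : Type u) (_ : Field E) (_ : IsAlgClosed E) (_ : Algebra K E) (a b : E)
      (D₁ D₂ : Derivation K E E), D₁ a = 1 ∧ D₁ b = 0 ∧ D₂ a = 0 ∧ D₂ b = 1 := by
  let S := MvPolynomial (Fin 2) K
  let F := FractionRing S
  let E := AlgebraicClosure F
  -- Both steps from `K[X₀, X₁]` to `E` are formally étale: a localization, then an algebraic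
  -- extension that is separable in characteristic zero. Hence the partial derivatives extend to
  -- `E`.
  have hSF : Algebra.FormallyEtale S F := Algebra.FormallyEtale.of_isLocalization (nonZeroDivisors S)
  have : CharZero F := charZero_of_injective_algebraMap (algebraMap K F).injective
  have hFE : Algebra.FormallyEtale F E := Algebra.FormallyEtale.of_isSeparable F E
  have : Algebra.FormallyEtale S E := Algebra.FormallyEtale.comp S F E
  obtain ⟨D₁, h₁⟩ := exists_derivation_extension K S E (pderiv 0)
  obtain ⟨D₂, h₂⟩ := exists_derivation_extension K S E (pderiv 1)
  refine ⟨E, inferInstance, inferInstance, inferInstance, algebraMap S E (X 0),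
    algebraMap S E (X 1), D₁, D₂, ?_, ?_, ?_, ?_⟩
  · rw [h₁, pderiv_X_self, map_one]
  · rw [h₁, pderiv_X_of_ne (by decide), map_zero]
  · rw [h₂, pderiv_X_of_ne (by decide), map_zero]
  · rw [h₂, pderiv_X_self, map_one]

variable {K E : Type*} [Field K] [Field E] [Algebra K E]

lemma coeff_prod_of_natDegree_le_sum {ι R : Type*} [CommRing R] (s : Finset ι)
    (p : ι → Polynomial R) (d : ι → ℕ) (hp : ∀ i, (p i).natDegree ≤ d i) :
    (∏ i ∈ s, p i).natDegree ≤ ∑ i ∈ s, d i ∧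
      (∏ i ∈ s, p i).coeff (∑ i ∈ s, d i) = ∏ i ∈ s, (p i).coeff (d i) := by
  classical
  induction s using Finset.induction_on with
  | empty => simp
  | insert a s ha ih =>
    rw [Finset.prod_insert ha, Finset.sum_insert ha, Finset.prod_insert ha]
    exact ⟨Polynomial.natDegree_mul_le_of_le (hp a) ih.1, by
      rw [Polynomial.coeff_mul_add_eq_of_natDegree_le (hp a) ih.1, ih.2]⟩

lemma natDegree_line_le (y v : E) :
    (Polynomial.C y + Polynomial.X * Polynomial.C v).natDegree ≤ 1 := by
  compute_degree

lemma coeff_aeval_line {h : MvPolynomial (Fin 4) K} {n : ℕ} (hh : h.IsHomogeneous n)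
    (y v : Fin 4 → E) :
    (aeval (fun i => Polynomial.C (y i) + Polynomial.X * Polynomial.C (v i)) h).coeff n =
      aeval v h := by
  conv_lhs => rw [h.as_sum]
  conv_rhs => rw [h.as_sum]
  rw [map_sum, map_sum, Polynomial.finsetSum_coeff]
  refine Finset.sum_congr rfl fun d hd => ?_
  have hdeg : ∑ i, d i = n := by
    have := hh (mem_support_iff.mp hd)
    rw [Finsupp.weight_apply, Finsupp.sum_fintype _ _ (by simp)] at this
    simpa using this
  rw [aeval_monomial, aeval_monomial, Finsupp.prod_fintype _ _ (fun _ => pow_zero _),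
    Finsupp.prod_fintype _ _ (fun _ => pow_zero _), Polynomial.algebraMap_apply,
    Polynomial.coeff_C_mul, ← hdeg]
  congr 1
  rw [(coeff_prod_of_natDegree_le_sum _ _ _ fun i =>
    (Polynomial.natDegree_pow_le_of_le (d i) (natDegree_line_le (y i) (v i))).trans
      (mul_one _).le).2]
  refine Finset.prod_congr rfl fun i _ => ?_
  have := Polynomial.coeff_pow_of_natDegree_le (m := d i) (natDegree_line_le (y i) (v i))
  rw [mul_one] at this
  rw [this]
  simp

lemma natDegree_aeval_line_le {h : MvPolynomial (Fin 4) K} {n : ℕ} (hh : h.IsHomogeneous n)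
    (y v : Fin 4 → E) :
    (aeval (fun i => Polynomial.C (y i) + Polynomial.X * Polynomial.C (v i)) h).natDegree ≤ n := by
  conv_lhs => rw [h.as_sum]
  rw [map_sum]
  refine Polynomial.natDegree_sum_le_of_forall_le _ _ fun d hd => ?_
  have hdeg : ∑ i, d i = n := by
    have := hh (mem_support_iff.mp hd)
    rw [Finsupp.weight_apply, Finsupp.sum_fintype _ _ (by simp)] at this
    simpa using this
  rw [aeval_monomial, Finsupp.prod_fintype _ _ (fun _ => pow_zero _), Polynomial.algebraMap_apply,
    ← hdeg]
  refine (Polynomial.natDegree_C_mul_le _ _).trans ?_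
  exact (coeff_prod_of_natDegree_le_sum _ _ _ fun i =>
    (Polynomial.natDegree_pow_le_of_le (d i) (natDegree_line_le (y i) (v i))).trans
      (mul_one _).le).1

lemma eval_aeval_line (h : MvPolynomial (Fin 4) K) (y v : Fin 4 → E) (t : E) :
    (aeval (fun i => Polynomial.C (y i) + Polynomial.X * Polynomial.C (v i)) h).eval t =
      aeval (y + t • v) h := by
  have e := map_aeval_comp ((Polynomial.aeval t).restrictScalars K) h
    (fun i => Polynomial.C (y i) + Polynomial.X * Polynomial.C (v i))
  simp only [AlgHom.restrictScalars_apply, Polynomial.coe_aeval_eq_eval] at e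
  rw [e]
  congr 2
  funext i
  simp only [Polynomial.eval_add, Polynomial.eval_mul, Polynomial.eval_C, Polynomial.eval_X,
    Pi.add_apply, Pi.smul_apply, smul_eq_mul]

/-- A zero of a form which moves in all directions under two derivations. -/
lemma exists_generic_zero [IsAlgClosed E] [Infinite K] {h : MvPolynomial (Fin 4) K} {n : ℕ}
    (hn : n ≠ 0) (hh : h.IsHomogeneous n) (h0 : h ≠ 0) {a b : E} {D₁ D₂ : Derivation K E E}
    (h1a : D₁ a = 1) (h1b : D₁ b = 0) (h2a : D₂ a = 0) (h2b : D₂ b = 1) :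
    ∃ x : Fin 4 → E, aeval x h = 0 ∧
      ∀ α β γ : E, (∀ i, α * x i + β * D₁ (x i) + γ * D₂ (x i) = 0) → α = 0 ∧ β = 0 ∧ γ = 0 := by
  obtain ⟨v, hv⟩ : ∃ v : Fin 4 → K, eval v h ≠ 0 := by
    by_contra! hc
    exact h0 (MvPolynomial.funext fun v => by rw [hc v, map_zero])
  obtain ⟨j, hj⟩ : ∃ j, v j ≠ 0 := by
    by_contra! hc
    apply hv
    have : v = 0 := _root_.funext hc
    rw [this, eval_zero, constantCoeff_eq]
    exact hh.coeff_eq_zero (by simpa using hn.symm)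
  -- The point is sought on the line through `y`, with coordinates `0, a, b, 1`, in a constant
  -- direction `v` with `h(v) ≠ 0`. Then `h` restricted to the line has degree exactly `n` and so
  -- has a root `z`.
  let v' : Fin 4 → E := fun i => algebraMap K E (v i)
  let c : Fin 3 → E := ![a, b, 1]
  let y : Fin 4 → E := j.insertNth 0 c
  have hcoeff := coeff_aeval_line hh y v'
  have hv' : aeval v' h ≠ 0 := by
    have e := map_aeval_comp (Algebra.ofId K E) h v
    simp only [Algebra.ofId_apply] at e
    rw [show aeval v' h = algebraMap K E (aeval v h) from e.symm, ← eval_eq_aeval]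
    simpa using hv
  have hdeg : (aeval (fun i => Polynomial.C (y i) + Polynomial.X * Polynomial.C (v' i))
      h).degree ≠ 0 := by
    intro hd
    apply hv'
    rw [← hcoeff]
    exact Polynomial.coeff_eq_zero_of_natDegree_lt (by
      rw [Polynomial.natDegree_eq_of_degree_eq_some hd]; exact Nat.pos_of_ne_zero hn)
  obtain ⟨z, hz⟩ := IsAlgClosed.exists_root _ hdeg
  refine ⟨y + z • v', by rw [← eval_aeval_line]; exact hz, fun α β γ hall => ?_⟩
  have hconst : ∀ (D : Derivation K E E) (i : Fin 4), D (v' i) = 0 := fun D i =>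
    D.map_algebraMap (v i)
  have hyj : y j = 0 := by simp [y]
  -- Coordinate `j` isolates `z`, since `y j = 0` and `v j ≠ 0`. The other coordinates then give the
  -- relation for `a, b, 1`, whose derivatives are known.
  have hτ : α * z + β * D₁ z + γ * D₂ z = 0 := by
    have h1 := hall j
    simp only [Pi.add_apply, Pi.smul_apply, smul_eq_mul, hyj, map_add, Derivation.leibniz, map_zero,
      hconst] at h1
    have h2 : v' j ≠ 0 := by simpa [v'] using hj
    apply mul_right_cancel₀ h2
    linear_combination h1
  have hk : ∀ k : Fin 3, α * c k + β * D₁ (c k) + γ * D₂ (c k) = 0 := by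
    intro k
    have h1 := hall (j.succAbove k)
    have hyk : y (j.succAbove k) = c k := by simp [y]
    simp only [Pi.add_apply, Pi.smul_apply, smul_eq_mul, hyk, map_add, Derivation.leibniz,
      hconst] at h1
    linear_combination h1 - v' (j.succAbove k) * hτ
  have k0 := hk 0
  have k1 := hk 1
  have k2 := hk 2
  simp [c, h1a, h1b, h2a, h2b] at k0 k1 k2
  subst k2
  rw [zero_mul, zero_add] at k0 k1
  exact ⟨rfl, k0, k1⟩

end GenericPoint

/-! ### Gradient and Hessian under derivations, Euler relations, and lines of high contact. -/

section Calculus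

variable {K A : Type*} [Field K] [CommRing A] [Algebra K A]

/-- The gradient of `f` at a point with coordinates in a `K`-algebra. -/
noncomputable def grad (f : MvPolynomial (Fin 4) K) (y : Fin 4 → A) : Fin 4 → A :=
  fun i => aeval y (pderiv i f)

/-- The Hessian bilinear form of `f` at a point with coordinates in a `K`-algebra. -/
noncomputable def hess (f : MvPolynomial (Fin 4) K) (y a b : Fin 4 → A) : A :=
  ∑ i, ∑ j, aeval y (pderiv i (pderiv j f)) * a i * b j

/-- A derivation applied to the coordinates of a vector. -/
def dvec (D : Derivation K A A) (y : Fin 4 → A) : Fin 4 → A := fun i => D (y i)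

lemma pderiv_comm {σ : Type*} (i j : σ) (f : MvPolynomial σ K) :
    pderiv i (pderiv j f) = pderiv j (pderiv i f) := by
  classical
  have h : ⁅(pderiv i : Derivation K (MvPolynomial σ K) (MvPolynomial σ K)),
      (pderiv j : Derivation K (MvPolynomial σ K) (MvPolynomial σ K))⁆ = 0 := by
    apply derivation_ext
    intro k
    rw [Derivation.commutator_apply]
    simp only [pderiv_X, Pi.single_apply, Derivation.coe_zero, Pi.zero_apply]
    split_ifs <;> simp
  have h2 := congrArg (fun D : Derivation K _ _ => D f) h
  rw [Derivation.commutator_apply] at h2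
  exact sub_eq_zero.mp h2

variable (f : MvPolynomial (Fin 4) K)

lemma hess_comm (y a b : Fin 4 → A) : hess f y a b = hess f y b a := by
  rw [hess, hess, Finset.sum_comm]
  refine Finset.sum_congr rfl fun i _ => Finset.sum_congr rfl fun j _ => ?_
  rw [pderiv_comm]
  ring

lemma hess_add_right (y a b c : Fin 4 → A) : hess f y a (b + c) = hess f y a b + hess f y a c := by
  simp [hess, mul_add, Finset.sum_add_distrib]

lemma hess_smul_right (y a b : Fin 4 → A) (t : A) : hess f y a (t • b) = t * hess f y a b := by
  simp only [hess, Finset.mul_sum, Pi.smul_apply, smul_eq_mul]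
  refine Finset.sum_congr rfl fun i _ => Finset.sum_congr rfl fun j _ => ?_
  ring

lemma hess_add_left (y a b c : Fin 4 → A) : hess f y (a + b) c = hess f y a c + hess f y b c := by
  rw [hess_comm, hess_add_right, hess_comm f y c a, hess_comm f y c b]

lemma hess_smul_left (y a b : Fin 4 → A) (t : A) : hess f y (t • a) b = t * hess f y a b := by
  rw [hess_comm, hess_smul_right, hess_comm f y b a]

lemma deriv_aeval (D : Derivation K A A) (y : Fin 4 → A) :
    D (aeval y f) = grad f y ⬝ᵥ dvec D y :=
  derivation_aeval D y f

lemma deriv_grad_dotProduct (D : Derivation K A A) (y z : Fin 4 → A) :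
    D (grad f y ⬝ᵥ z) = hess f y (dvec D y) z + grad f y ⬝ᵥ dvec D z := by
  rw [hess, Finset.sum_comm]
  simp only [dotProduct, map_sum, Derivation.leibniz, smul_eq_mul, grad, derivation_aeval,
    ← Finset.sum_add_distrib, dvec]
  refine Finset.sum_congr rfl fun i _ => ?_
  rw [Finset.mul_sum, add_comm]
  congr 1
  refine Finset.sum_congr rfl fun j _ => ?_
  ring

/-- With `y` constant under `D`, the third derivatives of `f` do not enter. -/
lemma deriv_hess (D : Derivation K A A) {y : Fin 4 → A} (hy : dvec D y = 0) (a b : Fin 4 → A) :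
    D (hess f y a b) = hess f y (dvec D a) b + hess f y a (dvec D b) := by
  have h0 : ∀ i, D (y i) = 0 := fun i => congrFun hy i
  simp only [hess, map_sum, Derivation.leibniz, smul_eq_mul, derivation_aeval, h0, mul_zero,
    Finset.sum_const_zero, ← Finset.sum_add_distrib, dvec]
  refine Finset.sum_congr rfl fun i _ => Finset.sum_congr rfl fun j _ => ?_
  ring

variable {f}

lemma euler_aeval {h : MvPolynomial (Fin 4) K} {n : ℕ} (hh : h.IsHomogeneous n) (y : Fin 4 → A) :
    ∑ i, y i * aeval y (pderiv i h) = n * aeval y h := by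
  have := congrArg (aeval y) hh.sum_X_mul_pderiv
  simpa using this

lemma grad_dotProduct_self (hf : f.IsHomogeneous 5) (y : Fin 4 → A) :
    grad f y ⬝ᵥ y = 5 * aeval y f := by
  have := euler_aeval hf y
  rw [dotProduct_comm]
  exact_mod_cast this

lemma hess_self_left (hf : f.IsHomogeneous 5) (y z : Fin 4 → A) :
    hess f y y z = 4 * (grad f y ⬝ᵥ z) := by
  rw [hess, Finset.sum_comm, dotProduct, Finset.mul_sum]
  refine Finset.sum_congr rfl fun j _ => ?_
  have := euler_aeval (hf.pderiv (i := j)) y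
  simp only [Nat.reduceSub, Nat.cast_ofNat] at this
  rw [grad, ← mul_assoc, ← this, Finset.sum_mul]
  refine Finset.sum_congr rfl fun i _ => ?_
  ring

variable {E : Type*} [Field E] [Algebra K E]

/-- The parametrized line `y + t v` over the polynomial ring. -/
noncomputable def polyLine (y v : Fin 4 → E) : Fin 4 → Polynomial E :=
  fun i => Polynomial.C (y i) + Polynomial.X * Polynomial.C (v i)

/-- A constant vector over the polynomial ring. -/
noncomputable def constVec (z : Fin 4 → E) : Fin 4 → Polynomial E := fun i => Polynomial.C (z i)

lemma eval_aeval_polyLine (h : MvPolynomial (Fin 4) K) (y v : Fin 4 → E) (t : E) :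
    (aeval (polyLine y v) h).eval t = aeval (y + t • v) h := eval_aeval_line h y v t

lemma eval_grad_polyLine (y v z : Fin 4 → E) (t : E) :
    (grad f (polyLine y v) ⬝ᵥ constVec z).eval t = grad f (y + t • v) ⬝ᵥ z := by
  simp [dotProduct, grad, constVec, Polynomial.eval_finsetSum, eval_aeval_polyLine]

lemma eval_hess_polyLine (y v a b : Fin 4 → E) (t : E) :
    (hess f (polyLine y v) (constVec a) (constVec b)).eval t = hess f (y + t • v) a b := by
  simp [hess, constVec, Polynomial.eval_finsetSum, eval_aeval_polyLine]

lemma coeff_grad_polyLine (hf : f.IsHomogeneous 5) (y v z : Fin 4 → E) :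
    (grad f (polyLine y v) ⬝ᵥ constVec z).coeff 4 = grad f v ⬝ᵥ z := by
  simp only [dotProduct, grad, constVec, Polynomial.finsetSum_coeff, Polynomial.coeff_mul_C]
  refine Finset.sum_congr rfl fun i _ => ?_
  exact congrArg (· * z i) (coeff_aeval_line (hf.pderiv (i := i)) y v)

lemma coeff_hess_polyLine (hf : f.IsHomogeneous 5) (y v a b : Fin 4 → E) :
    (hess f (polyLine y v) (constVec a) (constVec b)).coeff 3 = hess f v a b := by
  simp only [hess, constVec, Polynomial.finsetSum_coeff, Polynomial.coeff_mul_C]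
  refine Finset.sum_congr rfl fun i _ => Finset.sum_congr rfl fun j _ => ?_
  exact congrArg (· * a i * b j) (coeff_aeval_line (hessian_isHomogeneous hf i j) y v)

/-- Formal differentiation as a derivation over the base field. -/
noncomputable def polyDeriv (K E : Type*) [Field K] [Field E] [Algebra K E] :
    Derivation K (Polynomial E) (Polynomial E) :=
  (Polynomial.derivative' (R := E)).restrictScalars K

lemma polyDeriv_apply (P : Polynomial E) : polyDeriv K E P = Polynomial.derivative P := rfl

lemma dvec_polyLine (y v : Fin 4 → E) : dvec (polyDeriv K E) (polyLine y v) = constVec v := by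
  funext i
  simp [dvec, polyDeriv_apply, polyLine, constVec]

lemma dvec_constVec (z : Fin 4 → E) : dvec (polyDeriv K E) (constVec z) = 0 := by
  funext i
  simp [dvec, polyDeriv_apply, constVec]

lemma polyLine_eq (y v : Fin 4 → E) :
    polyLine y v = constVec y + (Polynomial.X : Polynomial E) • constVec v := rfl

/-- A line with contact of order three with the quintic at two points lies on it. -/
lemma aeval_line_eq_zero [CharZero E] (hf : f.IsHomogeneous 5) {p x : Fin 4 → E}
    (p0 : aeval p f = 0) (p1 : grad f p ⬝ᵥ x = 0) (p2 : hess f p x x = 0)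
    (x0 : aeval x f = 0) (x1 : grad f x ⬝ᵥ p = 0) (x2 : hess f x p p = 0) :
    aeval (polyLine p x) f = 0 := by
  set P := aeval (polyLine p x) f with hP
  set V := grad f (polyLine p x) ⬝ᵥ constVec p with hV
  set W := hess f (polyLine p x) (constVec p) (constVec p) with hW
  have dP : Polynomial.derivative P = grad f (polyLine p x) ⬝ᵥ constVec x := by
    rw [← polyDeriv_apply (K := K), hP, deriv_aeval, dvec_polyLine]
  have ddP : Polynomial.derivative (Polynomial.derivative P) =
      hess f (polyLine p x) (constVec x) (constVec x) := by
    rw [dP, ← polyDeriv_apply (K := K), deriv_grad_dotProduct, dvec_polyLine, dvec_constVec]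
    simp
  have dV : Polynomial.derivative V = hess f (polyLine p x) (constVec x) (constVec p) := by
    rw [hV, ← polyDeriv_apply (K := K), deriv_grad_dotProduct, dvec_polyLine, dvec_constVec]
    simp
  -- Contact at `p` kills the coefficients 0, 1, 2 of `P`. Contact at `x`, the point at infinity of
  -- the line, kills 5, 4, 3; these Euler relations express coefficients 4 and 3 through the top
  -- coefficients of `V` and `W`.
  have eP : V + Polynomial.X * Polynomial.derivative P = 5 * P := by
    rw [← grad_dotProduct_self hf (polyLine p x)]
    conv_rhs => arg 2; rw [polyLine_eq]
    rw [dotProduct_add, dotProduct_smul, dP, hV, smul_eq_mul]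
  have eV : W + Polynomial.X * Polynomial.derivative V = 4 * V := by
    rw [hV, ← hess_self_left hf (polyLine p x)]
    conv_rhs => arg 3; rw [polyLine_eq]
    rw [hess_add_left, hess_smul_left, ← dV]
  have ev0 : ∀ Q : Polynomial E, Q.coeff 0 = Q.eval 0 := Polynomial.coeff_zero_eq_eval_zero
  have c0 : P.coeff 0 = 0 := by rw [ev0, eval_aeval_polyLine, zero_smul, add_zero, p0]
  have c1 : P.coeff 1 = 0 := by
    have h : (Polynomial.derivative P).coeff 0 = 0 := by
      rw [dP, ev0, eval_grad_polyLine, zero_smul, add_zero, p1]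
    rw [Polynomial.coeff_derivative] at h
    simpa using h
  have c2 : P.coeff 2 = 0 := by
    have h : (Polynomial.derivative (Polynomial.derivative P)).coeff 0 = 0 := by
      rw [ddP, ev0, eval_hess_polyLine, zero_smul, add_zero, p2]
    rw [Polynomial.coeff_derivative, Polynomial.coeff_derivative] at h
    norm_num at h
    exact h
  have c5 : P.coeff 5 = 0 := by
    exact (coeff_aeval_line hf p x).trans x0
  have n5 : (5 : Polynomial E) = Polynomial.C 5 := (map_ofNat Polynomial.C 5).symm
  have n4 : (4 : Polynomial E) = Polynomial.C 4 := (map_ofNat Polynomial.C 4).symm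
  rw [n5] at eP
  rw [n4] at eV
  have c4 : P.coeff 4 = 0 := by
    have h := congrArg (fun Q => Q.coeff 4) eP
    simp only [Polynomial.coeff_add, Polynomial.coeff_X_mul, Polynomial.coeff_C_mul,
      Polynomial.coeff_derivative] at h
    rw [hV, coeff_grad_polyLine hf, x1] at h
    push_cast at h
    linear_combination -h
  have v3 : V.coeff 3 = 0 := by
    have h := congrArg (fun Q => Q.coeff 3) eV
    simp only [Polynomial.coeff_add, Polynomial.coeff_X_mul, Polynomial.coeff_C_mul,
      Polynomial.coeff_derivative] at h
    rw [hW, coeff_hess_polyLine hf, x2] at h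
    push_cast at h
    linear_combination -h
  have c3 : P.coeff 3 = 0 := by
    have h := congrArg (fun Q => Q.coeff 3) eP
    simp only [Polynomial.coeff_add, Polynomial.coeff_X_mul, Polynomial.coeff_C_mul,
      Polynomial.coeff_derivative] at h
    rw [v3] at h
    push_cast at h
    have h' : (2 : E) * P.coeff 3 = 0 := by linear_combination -h
    simpa using h'
  have hdeg : P.natDegree ≤ 5 := natDegree_aeval_line_le hf p x
  ext k
  rw [Polynomial.coeff_zero]
  by_cases hk : k ≤ 5
  · interval_cases k <;> assumption
  · exact Polynomial.coeff_eq_zero_of_natDegree_lt (by omega)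

end Calculus

/-! ### Coordinates in four-space and in a hyperplane. -/

section LinearAlgebra

variable {E : Type*} [Field E]

lemma linearIndependent_triple_iff {V : Type*} [AddCommGroup V] [Module E V] {a b c : V} :
    LinearIndependent E ![a, b, c] ↔
      ∀ α β γ : E, α • a + β • b + γ • c = 0 → α = 0 ∧ β = 0 ∧ γ = 0 := by
  rw [Fintype.linearIndependent_iff]
  constructor
  · intro h α β γ e
    have := h ![α, β, γ] (by simpa [Fin.sum_univ_three] using e)
    exact ⟨this 0, this 1, this 2⟩
  · intro h g e
    have := h (g 0) (g 1) (g 2) (by simpa [Fin.sum_univ_three] using e)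
    intro i
    fin_cases i
    · exact this.1
    · exact this.2.1
    · exact this.2.2

lemma exists_coords_of_linearIndependent {b : Fin 4 → Fin 4 → E} (hb : LinearIndependent E b)
    (w : Fin 4 → E) : ∃ c : Fin 4 → E, ∑ i, c i • b i = w := by
  have h := hb.span_eq_top_of_card_eq_finrank (by simp)
  have hw : w ∈ Submodule.span E (Set.range b) := by rw [h]; trivial
  exact (Submodule.mem_span_range_iff_exists_fun E).mp hw

lemma eq_zero_of_dotProduct_eq_zero {b : Fin 4 → Fin 4 → E} (hb : LinearIndependent E b)
    {N : Fin 4 → E} (h : ∀ i, N ⬝ᵥ b i = 0) : N = 0 := by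
  apply dotProduct_eq_zero
  intro w
  obtain ⟨c, rfl⟩ := exists_coords_of_linearIndependent hb w
  rw [dotProduct_sum]
  simp [h]

/-- Three independent vectors span the hyperplane containing them. -/
lemma exists_coords_of_dotProduct_eq_zero {a b c N w : Fin 4 → E}
    (habc : LinearIndependent E ![a, b, c]) (hN : N ≠ 0) (ha : N ⬝ᵥ a = 0) (hb : N ⬝ᵥ b = 0)
    (hc : N ⬝ᵥ c = 0) (hw : N ⬝ᵥ w = 0) : ∃ α β γ : E, w = α • a + β • b + γ • c := by
  by_contra! hcon
  apply hN
  have hli : LinearIndependent E (Fin.cons w ![a, b, c] : Fin 4 → Fin 4 → E) := by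
    rw [linearIndependent_finCons]
    refine ⟨habc, fun hmem => ?_⟩
    obtain ⟨g, hg⟩ := (Submodule.mem_span_range_iff_exists_fun E).mp hmem
    rw [Fin.sum_univ_three] at hg
    exact hcon (g 0) (g 1) (g 2) hg.symm
  refine eq_zero_of_dotProduct_eq_zero hli fun i => ?_
  fin_cases i <;> assumption

end LinearAlgebra

/-! ### Rigidity of lines on a smooth quintic. -/

section Rigidity

variable {K E : Type*} [Field K] [Field E] [Algebra K E] {f : MvPolynomial (Fin 4) K}

lemma dvec_add (D : Derivation K E E) (y z : Fin 4 → E) :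
    dvec D (y + z) = dvec D y + dvec D z := by
  funext i
  simp [dvec]

lemma dvec_smul (D : Derivation K E E) (t : E) (z : Fin 4 → E) :
    dvec D (t • z) = D t • z + t • dvec D z := by
  funext i
  simp only [dvec, Pi.smul_apply, smul_eq_mul, Derivation.leibniz, Pi.add_apply]
  ring

lemma grad_line_dotProduct_direction {p x : Fin 4 → E} (h : aeval (polyLine x p) f = 0) (t : E) :
    grad f (x + t • p) ⬝ᵥ p = 0 := by
  have e := congrArg (polyDeriv K E) h
  rw [deriv_aeval, dvec_polyLine, map_zero] at e
  rw [← eval_grad_polyLine, e, Polynomial.eval_zero]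

lemma grad_line_dotProduct_base (hf : f.IsHomogeneous 5) {p x : Fin 4 → E}
    (h : aeval (polyLine x p) f = 0) (t : E) : grad f (x + t • p) ⬝ᵥ x = 0 := by
  have h1 := grad_line_dotProduct_direction h t
  have h2 := grad_dotProduct_self hf (x + t • p)
  rw [← eval_aeval_polyLine, h, Polynomial.eval_zero, mul_zero, dotProduct_add, dotProduct_smul,
    h1, smul_zero, add_zero] at h2
  exact h2

/-- The gradient along a moving line on the surface annihilates the velocity of the line. -/
lemma grad_line_dotProduct_velocity {p x : Fin 4 → E} (h : aeval (polyLine x p) f = 0)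
    (D : Derivation K E E) (t : E) :
    grad f (x + t • p) ⬝ᵥ (dvec D x + t • dvec D p) = 0 := by
  have h1 := grad_line_dotProduct_direction h t
  have hz : aeval (x + t • p) f = 0 := by rw [← eval_aeval_polyLine, h]; simp
  have e := congrArg D hz
  rw [deriv_aeval, map_zero, dvec_add, dvec_smul, dotProduct_add, dotProduct_add,
    dotProduct_smul, h1, smul_zero, zero_add] at e
  rw [dotProduct_add]
  exact e

/-- Two polynomials with `A (1 + e X) + c X B = 0`, one of which has a nonzero coefficient in degree
four, have a common root. -/
lemma exists_common_root [IsAlgClosed E] {A B : Polynomial E} {e c : E}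
    (h : A * (1 + Polynomial.C e * Polynomial.X) + Polynomial.C c * Polynomial.X * B = 0)
    (h4 : ¬ (A.coeff 4 = 0 ∧ B.coeff 4 = 0)) : ∃ t, A.eval t = 0 ∧ B.eval t = 0 := by
  -- The linear factors `1 + eX` and `cX` are coprime, so `A` and `B` share a factor `G` with
  -- cofactors of degree at most one. A nonzero coefficient in degree four forces `G` to be
  -- nonconstant or zero.
  obtain ⟨G, a, b, rfl, rfl, ha, hb⟩ : ∃ G a b : Polynomial E, A = G * a ∧ B = G * b ∧
      a.natDegree ≤ 1 ∧ b.natDegree ≤ 1 := by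
    by_cases hc : c = 0
    · refine ⟨B, 0, 1, ?_, (mul_one _).symm, by simp, by simp⟩
      rw [hc, map_zero, zero_mul, zero_mul, add_zero, mul_eq_zero] at h
      rw [mul_zero]
      refine h.resolve_right fun h1 => ?_
      have := congrArg (Polynomial.eval 0) h1
      simp at this
    · have hX : Polynomial.X ∣ A := by
        rw [Polynomial.X_dvd_iff, Polynomial.coeff_zero_eq_eval_zero]
        have := congrArg (Polynomial.eval 0) h
        simpa using this
      obtain ⟨A', rfl⟩ := hX
      refine ⟨A', Polynomial.X, -Polynomial.C c⁻¹ * (1 + Polynomial.C e * Polynomial.X),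
        mul_comm _ _, ?_, Polynomial.natDegree_X_le, by compute_degree⟩
      have h1 : A' * (1 + Polynomial.C e * Polynomial.X) + Polynomial.C c * B = 0 := by
        apply mul_left_cancel₀ (Polynomial.X_ne_zero (R := E))
        linear_combination h
      have h2 : Polynomial.C c⁻¹ * Polynomial.C c = 1 := by
        rw [← map_mul, inv_mul_cancel₀ hc, map_one]
      linear_combination -(B * h2) + Polynomial.C c⁻¹ * h1
  by_cases hG : G.degree = 0
  · exfalso
    apply h4
    have hG' : G.natDegree = 0 := Polynomial.natDegree_eq_of_degree_eq_some hG
    have : ∀ a : Polynomial E, a.natDegree ≤ 1 → (G * a).coeff 4 = 0 := fun a ha =>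
      Polynomial.coeff_eq_zero_of_natDegree_lt
        ((Polynomial.natDegree_mul_le_of_le hG'.le ha).trans_lt (by norm_num))
    exact ⟨this a ha, this b hb⟩
  · obtain ⟨t, ht⟩ := IsAlgClosed.exists_root G hG
    rw [Polynomial.IsRoot] at ht
    exact ⟨t, by rw [Polynomial.eval_mul, ht, zero_mul], by rw [Polynomial.eval_mul, ht, zero_mul]⟩

/-- A line on a smooth quintic does not move. -/
lemma false_of_moving_line [IsAlgClosed E] (hf : f.IsHomogeneous 5)
    (hs : ∀ y : Fin 4 → E, grad f y = 0 → y = 0) {p x : Fin 4 → E}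
    (h : aeval (polyLine x p) f = 0) {D : Derivation K E E}
    (hli : LinearIndependent E ![p, x, dvec D x]) : False := by
  obtain ⟨c, hc⟩ := exists_linearIndependent_cons_of_lt_finrank hli (by simp)
  obtain ⟨e, he⟩ := exists_coords_of_linearIndependent hc (dvec D p)
  rw [Fin.sum_univ_four] at he
  simp only [Fin.cons_zero] at he
  change e 0 • c + e 1 • p + e 2 • x + e 3 • dvec D x = dvec D p at he
  set v := dvec D x with hv
  set A := grad f (polyLine x p) ⬝ᵥ constVec v with hA
  set B := grad f (polyLine x p) ⬝ᵥ constVec c with hB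
  have hgrad : ∀ y, grad f y ⬝ᵥ c = 0 → grad f y ⬝ᵥ p = 0 → grad f y ⬝ᵥ x = 0 →
      grad f y ⬝ᵥ v = 0 → y = 0 := by
    intro y h0 h1 h2 h3
    refine hs y (eq_zero_of_dotProduct_eq_zero hc fun i => ?_)
    fin_cases i <;> assumption
  rw [linearIndependent_triple_iff] at hli
  have hp0 : p ≠ 0 := by
    rintro rfl
    have := hli 1 0 0 (by simp)
    simp at this
  -- The gradient along the line kills `p`, `x` and the velocity `v + t · Dp`. Expanding `Dp` in the
  -- basis `c, p, x, v` leaves a relation between its pairings with `v` and `c`.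
  have hAB : A * (1 + Polynomial.C (e 3) * Polynomial.X) + Polynomial.C (e 0) * Polynomial.X * B
      = 0 := by
    apply Polynomial.funext
    intro t
    simp only [Polynomial.eval_add, Polynomial.eval_mul, Polynomial.eval_one, Polynomial.eval_C,
      Polynomial.eval_X, Polynomial.eval_zero, hA, hB, eval_grad_polyLine]
    have h1 := grad_line_dotProduct_direction h t
    have h2 := grad_line_dotProduct_base hf h t
    have h3 := grad_line_dotProduct_velocity h D t
    rw [← he, dotProduct_add, dotProduct_smul] at h3
    simp only [dotProduct_add, dotProduct_smul, h1, h2, smul_eq_mul, mul_zero, add_zero] at h3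
    linear_combination h3
  -- The degree-four coefficients are the values at `p`, the point at infinity of the line. A common
  -- zero there, or at finite `t`, makes the gradient vanish at a nonzero vector.
  by_cases h4 : A.coeff 4 = 0 ∧ B.coeff 4 = 0
  · rw [hA, hB, coeff_grad_polyLine hf, coeff_grad_polyLine hf] at h4
    have hg : ∀ z : Fin 4 → E, (∀ t : E, grad f (x + t • p) ⬝ᵥ z = 0) → grad f p ⬝ᵥ z = 0 := by
      intro z hz
      have : grad f (polyLine x p) ⬝ᵥ constVec z = 0 := Polynomial.funext fun t => by
        rw [eval_grad_polyLine, hz, Polynomial.eval_zero]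
      rw [← coeff_grad_polyLine hf x, this, Polynomial.coeff_zero]
    exact hp0 (hgrad p h4.2 (hg p (grad_line_dotProduct_direction h))
      (hg x (grad_line_dotProduct_base hf h)) h4.1)
  · obtain ⟨t, h1, h2⟩ := exists_common_root hAB h4
    rw [hA, eval_grad_polyLine] at h1
    rw [hB, eval_grad_polyLine] at h2
    have := hgrad _ h2 (grad_line_dotProduct_direction h t) (grad_line_dotProduct_base hf h t) h1
    have := hli t 1 0 (by rw [← this]; simp [add_comm])
    simp at this

variable {D₁ D₂ : Derivation K E E}

/-- A point moving in two directions on a smooth quintic does not move along a fixed direction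
towards an asymptotic point that is constant in that direction. -/
lemma false_of_velocity_mem_line [IsAlgClosed E] [CharZero E] (hf : f.IsHomogeneous 5)
    (hs : ∀ y : Fin 4 → E, grad f y = 0 → y = 0) {p x : Fin 4 → E}
    (hx : LinearIndependent E ![x, dvec D₁ x, dvec D₂ x])
    (x0 : aeval x f = 0) (p0 : aeval p f = 0) (p1 : grad f p ⬝ᵥ x = 0) (p2 : hess f p x x = 0)
    {D : Derivation K E E} (hDp : dvec D p = 0) {α β : E} (hDx : dvec D x = α • x + β • p)
    (hxD : ∀ a b : E, a • x + b • dvec D x = 0 → a = 0 ∧ b = 0) : False := by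
  have hβ : β ≠ 0 := by
    rintro rfl
    have := hxD (-α) 1 (by rw [hDx]; simp)
    simp at this
  have hpx : ∀ a b : E, a • p + b • x = 0 → a = 0 ∧ b = 0 := by
    intro a b hab
    have h1 := hxD (b * β - a * α) a (by
      have h2 : β • (a • p + b • x) = 0 := by rw [hab, smul_zero]
      rw [hDx, ← h2]
      module)
    refine ⟨h1.2, ?_⟩
    have := h1.1
    rw [h1.2, zero_mul, sub_zero] at this
    exact (mul_eq_zero.mp this).resolve_right hβ
  -- As `x` stays on the surface and moves towards `p`, differentiating `f(x) = 0` twice along `D`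
  -- gives contact of order three at `x`.
  have x1 : grad f x ⬝ᵥ p = 0 := by
    have e := congrArg D x0
    rw [deriv_aeval, hDx, dotProduct_add, dotProduct_smul, dotProduct_smul,
      grad_dotProduct_self hf, x0, map_zero] at e
    simpa [hβ] using e
  have x2 : hess f x p p = 0 := by
    have e := congrArg D x1
    rw [deriv_grad_dotProduct, hDp, hDx, hess_add_left, hess_smul_left, hess_smul_left,
      hess_self_left hf, x1, map_zero] at e
    simpa [hβ] using e
  have hline := aeval_line_eq_zero hf x0 x1 x2 p0 p1 p2
  -- Since the line cannot move, every derivation keeps `x` in the span of `x` and `p`. Three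
  -- independent vectors do not fit into this plane.
  have key : ∀ D : Derivation K E E, ∃ a b : E, dvec D x = a • x + b • p := by
    intro D
    by_contra! hcon
    refine false_of_moving_line hf hs hline (D := D) ?_
    rw [linearIndependent_triple_iff]
    intro a b c habc
    by_cases hc : c = 0
    · rw [hc, zero_smul, add_zero] at habc
      exact ⟨(hpx a b habc).1, (hpx a b habc).2, hc⟩
    · exfalso
      apply hcon (-(c⁻¹ * b)) (-(c⁻¹ * a))
      have h2 : c⁻¹ • (a • p + b • x + c • dvec D x) = 0 := by rw [habc, smul_zero]
      have h3 : c⁻¹ • c • dvec D x = dvec D x := by rw [smul_smul, inv_mul_cancel₀ hc, one_smul]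
      rw [smul_add, h3] at h2
      rw [eq_neg_of_add_eq_zero_right h2]
      module
  obtain ⟨a₁, b₁, h₁⟩ := key D₁
  obtain ⟨a₂, b₂, h₂⟩ := key D₂
  rw [linearIndependent_triple_iff] at hx
  have h := hx (b₁ * a₂ - b₂ * a₁) b₂ (-b₁) (by rw [h₁, h₂]; module)
  have h' := hx (-a₁) 1 0 (by
    have hb : b₁ = 0 := by simpa using h.2.2
    rw [h₁, hb]
    module)
  simpa using h'.2.1

/-- The case of a point that does not move at all. -/
lemma false_of_constant_point [IsAlgClosed E] [CharZero E] (hf : f.IsHomogeneous 5)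
    (hs : ∀ y : Fin 4 → E, grad f y = 0 → y = 0) {p x : Fin 4 → E} (hp : p ≠ 0)
    (hx : LinearIndependent E ![x, dvec D₁ x, dvec D₂ x])
    (x0 : aeval x f = 0) (p0 : aeval p f = 0) (p1 : grad f p ⬝ᵥ x = 0) (p2 : hess f p x x = 0)
    (h₁ : dvec D₁ p = 0) (h₂ : dvec D₂ p = 0) : False := by
  have hN : grad f p ≠ 0 := fun h => hp (hs p h)
  have hconst : ∀ D : Derivation K E E, dvec D p = 0 → grad f p ⬝ᵥ dvec D x = 0 := by
    intro D hD
    have e := congrArg D p1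
    rw [deriv_grad_dotProduct, hD, map_zero] at e
    simpa [hess] using e
  have hpp : grad f p ⬝ᵥ p = 0 := by rw [grad_dotProduct_self hf, p0, mul_zero]
  -- The constant tangent hyperplane at `p` is spanned by `x, D₁x, D₂x` and contains `p`, so some
  -- combination of the derivations moves `x` towards `p`.
  obtain ⟨a, b, c, habc⟩ := exists_coords_of_dotProduct_eq_zero hx hN p1 (hconst _ h₁)
    (hconst _ h₂) hpp
  rw [linearIndependent_triple_iff] at hx
  set D := b • D₁ + c • D₂ with hD
  have hDv : ∀ y, dvec D y = b • dvec D₁ y + c • dvec D₂ y := by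
    intro y
    funext i
    simp [dvec, hD]
  have hDp : dvec D p = 0 := by rw [hDv, h₁, h₂]; simp
  -- Otherwise `p` would be a multiple of `x`, and a constant `p` would make `D₁x` proportional to
  -- `x`.
  have hbc : b ≠ 0 ∨ c ≠ 0 := by
    by_contra! hc
    rw [hc.1, hc.2, zero_smul, zero_smul, add_zero, add_zero] at habc
    have ha : a ≠ 0 := by
      rintro rfl
      exact hp (by rw [habc, zero_smul])
    rw [habc, dvec_smul] at h₁
    have := hx (D₁ a) a 0 (by rw [zero_smul, add_zero]; exact h₁)
    exact ha this.2.1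
  refine false_of_velocity_mem_line (D₁ := D₁) (D₂ := D₂) hf hs
    (linearIndependent_triple_iff.mpr hx) x0 p0 p1 p2 (D := D) hDp (α := -a) (β := 1) ?_ ?_
  · rw [hDv, habc]
    module
  · intro s t hst
    rw [hDv] at hst
    have := hx s (t * b) (t * c) (by rw [← hst]; module)
    refine ⟨this.1, ?_⟩
    rcases hbc with hb | hc
    · exact (mul_eq_zero.mp this.2.1).resolve_right hb
    · exact (mul_eq_zero.mp this.2.2).resolve_right hc

end Rigidity

/-! ### The surface `V(f)` is not a component of `V(R)`. -/

section NoComponent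

variable {K E : Type*} [Field K] [Field E] [Algebra K E] {f : MvPolynomial (Fin 4) K}
  {D₁ D₂ : Derivation K E E}

/-- The second fundamental form at a constant asymptotic point `p` of a moving point `x` vanishes on
the tangent plane, unless `x` moves along the line joining it to `p`. -/
lemma hess_eq_zero_of_grad_dotProduct_eq_zero [CharZero E] (hf : f.IsHomogeneous 5) {p x : Fin 4 → E}
    (p1 : grad f p ⬝ᵥ x = 0) (p2 : hess f p x x = 0) (hN : grad f p ≠ 0)
    {D : Derivation K E E} (hDp : dvec D p = 0) (p0 : aeval p f = 0)
    (hli : LinearIndependent E ![p, x, dvec D x]) {a b : Fin 4 → E} (ha : grad f p ⬝ᵥ a = 0)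
    (hb : grad f p ⬝ᵥ b = 0) : hess f p a b = 0 := by
  set y := dvec D x with hy
  have hpp : grad f p ⬝ᵥ p = 0 := by rw [grad_dotProduct_self hf, p0, mul_zero]
  have hz : ∀ w, hess f p (0 : Fin 4 → E) w = 0 := fun w => by simp [hess]
  have hvel : ∀ w, grad f p ⬝ᵥ w = 0 → grad f p ⬝ᵥ dvec D w = 0 := by
    intro w hw
    have e := congrArg D hw
    rwa [deriv_grad_dotProduct, hDp, hz, zero_add, map_zero] at e
  have hpy := hvel x p1
  have hxy : hess f p x y = 0 := by
    have e := congrArg D p2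
    rw [deriv_hess f D hDp, map_zero, hess_comm f p (dvec D x), ← two_mul] at e
    simpa using e
  have hpw : ∀ w, grad f p ⬝ᵥ w = 0 → hess f p p w = 0 := by
    intro w hw
    rw [hess_self_left hf, hw, mul_zero]
  -- The tangent hyperplane at `p` is fixed by `D`, so `D²x` lies in the span of `p, x, Dx`, each of
  -- which is orthogonal to `x` for the Hessian form. Differentiating `hess(x, Dx) = 0` then gives
  -- `hess(Dx, Dx) = 0`.
  obtain ⟨α, β, γ, hDy⟩ := exists_coords_of_dotProduct_eq_zero hli hN hpp p1 hpy (hvel y hpy)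
  have hyy : hess f p y y = 0 := by
    have e := congrArg D hxy
    rw [deriv_hess f D hDp, map_zero, hDy, hess_add_right, hess_add_right, hess_smul_right,
      hess_smul_right, hess_smul_right, hess_comm f p x p, hpw x p1, p2, hxy] at e
    simpa using e
  obtain ⟨a₁, a₂, a₃, rfl⟩ := exists_coords_of_dotProduct_eq_zero hli hN hpp p1 hpy ha
  have hxb : hess f p x b = 0 ∧ hess f p y b = 0 := by
    obtain ⟨b₁, b₂, b₃, rfl⟩ := exists_coords_of_dotProduct_eq_zero hli hN hpp p1 hpy hb
    constructor
    · simp only [hess_add_right, hess_smul_right, hess_comm f p x p, hpw x p1, p2, hxy]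
      simp
    · simp only [hess_add_right, hess_smul_right, hess_comm f p y p, hess_comm f p y x, hpw y hpy,
        hyy, hxy]
      simp
  rw [hess_add_left, hess_add_left, hess_smul_left, hess_smul_left, hess_smul_left, hpw b hb,
    hxb.1, hxb.2]
  simp

/-- The columns of a matrix, as vectors over an extension field. -/
noncomputable def colVec (E : Type*) [Field E] [Algebra K E] (M : Matrix (Fin 4) (Fin 4) K)
    (j : Fin 4) : Fin 4 → E := fun i => algebraMap K E (M i j)

lemma dvec_colVec (D : Derivation K E E) (M : Matrix (Fin 4) (Fin 4) K) (j : Fin 4) :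
    dvec D (colVec E M j) = 0 := funext fun i => D.map_algebraMap (M i j)

lemma cubicPoint_one_eq (M : Matrix (Fin 4) (Fin 4) K) (s : E) :
    cubicPoint M ![1, s] =
      colVec E M 0 + s • colVec E M 1 + s ^ 2 • colVec E M 2 + s ^ 3 • colVec E M 3 := by
  funext i
  simp [cubicPoint, Fin.sum_univ_four, colVec, mul_comm]

lemma cubicPoint_zero_one (M : Matrix (Fin 4) (Fin 4) K) :
    cubicPoint M (![0, 1] : Fin 2 → E) = colVec E M 3 := by
  funext i
  simp [cubicPoint, Fin.sum_univ_four, colVec]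

lemma eq_zero_of_dotProduct_colVec {M : Matrix (Fin 4) (Fin 4) K} (hM : M.det ≠ 0)
    {N : Fin 4 → E} (h : ∀ j, N ⬝ᵥ colVec E M j = 0) : N = 0 := by
  have hdet : (M.map (algebraMap K E)).det ≠ 0 := by
    rw [← RingHom.mapMatrix_apply, ← RingHom.map_det]
    simpa using hM
  exact Matrix.eq_zero_of_vecMul_eq_zero hdet (funext h)

lemma linearIndependent_colVec {M : Matrix (Fin 4) (Fin 4) K} (hM : M.det ≠ 0) :
    LinearIndependent E (colVec E M) := by
  have hdet : (M.map (algebraMap K E)).transpose.det ≠ 0 := by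
    rw [Matrix.det_transpose, ← RingHom.mapMatrix_apply, ← RingHom.map_det]
    simpa using hM
  exact Matrix.linearIndependent_rows_of_det_ne_zero hdet

lemma cubicPoint_ne_zero {M : Matrix (Fin 4) (Fin 4) K} (hM : M.det ≠ 0) {u : Fin 2 → E}
    (hu : (∃ t, u = ![1, t]) ∨ u = ![0, 1]) : cubicPoint M u ≠ 0 := by
  have h := Fintype.linearIndependent_iff.mp (linearIndependent_colVec (E := E) hM)
  intro h0
  rcases hu with ⟨t, rfl⟩ | rfl
  · rw [cubicPoint_one_eq] at h0
    have := h ![1, t, t ^ 2, t ^ 3] (by simpa [Fin.sum_univ_four] using h0) 0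
    simp at this
  · rw [cubicPoint_zero_one] at h0
    have := h ![0, 0, 0, 1] (by simpa [Fin.sum_univ_four] using h0) 3
    simp at this

/-- The case of a point moving along the twisted cubic. -/
lemma false_of_moving_point [IsAlgClosed E] [CharZero E] (hf : f.IsHomogeneous 5)
    (hs : ∀ y : Fin 4 → E, grad f y = 0 → y = 0) {M : Matrix (Fin 4) (Fin 4) K} (hM : M.det ≠ 0)
    {s : E} {p x : Fin 4 → E} (hps : p = cubicPoint M ![1, s])
    (hx : LinearIndependent E ![x, dvec D₁ x, dvec D₂ x])
    (x0 : aeval x f = 0) (p0 : aeval p f = 0) (p1 : grad f p ⬝ᵥ x = 0) (p2 : hess f p x x = 0)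
    {D₀ : Derivation K E E} (hD₀ : D₀ s = 1) (hs12 : ¬ (D₁ s = 0 ∧ D₂ s = 0)) : False := by
  have hp : p ≠ 0 := hps ▸ cubicPoint_ne_zero hM (Or.inl ⟨s, rfl⟩)
  have hN : grad f p ≠ 0 := fun h => hp (hs p h)
  have hpp : grad f p ⬝ᵥ p = 0 := by rw [grad_dotProduct_self hf, p0, mul_zero]
  -- `q₁` and `q₂` are the first and second derivatives of the cubic with respect to its affine
  -- parameter.
  set q₁ := colVec E M 1 + (2 * s) • colVec E M 2 + (3 * s ^ 2) • colVec E M 3 with hq₁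
  set q₂ := (2 : E) • colVec E M 2 + (6 * s) • colVec E M 3 with hq₂
  have d2 : ∀ D : Derivation K E E, D (2 : E) = 0 := fun D => by
    simpa using D.map_natCast 2
  have d3 : ∀ D : Derivation K E E, D (3 : E) = 0 := fun D => by
    simpa using D.map_natCast 3
  have d6 : ∀ D : Derivation K E E, D (6 : E) = 0 := fun D => by
    simpa using D.map_natCast 6
  have hdp : ∀ D : Derivation K E E, dvec D p = D s • q₁ := by
    intro D
    rw [hps, cubicPoint_one_eq]
    simp only [dvec_add, dvec_smul, dvec_colVec, Derivation.leibniz_pow, smul_eq_mul, hq₁]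
    simp only [nsmul_eq_mul]
    push_cast
    module
  have hdq₁ : dvec D₀ q₁ = q₂ := by
    rw [hq₁]
    simp only [dvec_add, dvec_smul, dvec_colVec, Derivation.leibniz, Derivation.leibniz_pow,
      smul_eq_mul, d2, d3, hD₀, hq₂]
    simp only [nsmul_eq_mul]
    push_cast
    module
  have hdq₂ : dvec D₀ q₂ = (6 : E) • colVec E M 3 := by
    rw [hq₂]
    simp only [dvec_add, dvec_smul, dvec_colVec, Derivation.leibniz,
      smul_eq_mul, d2, d6, hD₀]
    module
  rw [linearIndependent_triple_iff] at hx
  -- This combination kills `s`, hence fixes `p`, but does not fix `x` even up to scaling.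
  set D := D₂ s • D₁ - D₁ s • D₂ with hD
  have hDv : ∀ y, dvec D y = D₂ s • dvec D₁ y - D₁ s • dvec D₂ y := by
    intro y
    funext i
    simp [dvec, hD]
  have hDp : dvec D p = 0 := by
    rw [hdp, hD]
    simp [mul_comm]
  have hxD : ∀ a b : E, a • x + b • dvec D x = 0 → a = 0 ∧ b = 0 := by
    intro a b hab
    rw [hDv] at hab
    have := hx a (b * D₂ s) (-(b * D₁ s)) (by rw [← hab]; module)
    refine ⟨this.1, ?_⟩
    by_contra hb
    apply hs12
    have h1 := this.2.1
    have h2 := this.2.2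
    rw [neg_eq_zero] at h2
    exact ⟨(mul_eq_zero.mp h2).resolve_left hb, (mul_eq_zero.mp h1).resolve_left hb⟩
  by_cases hspan : ∃ α β : E, dvec D x = α • x + β • p
  · obtain ⟨α, β, h⟩ := hspan
    exact false_of_velocity_mem_line (D₁ := D₁) (D₂ := D₂) hf hs
      (linearIndependent_triple_iff.mpr hx) x0 p0 p1 p2 hDp h hxD
  · have hli : LinearIndependent E ![p, x, dvec D x] := by
      rw [linearIndependent_triple_iff]
      intro a b c habc
      have ha : a = 0 := by
        by_contra ha
        have hpx : p = (-(a⁻¹ * b)) • x + (-(a⁻¹ * c)) • dvec D x := by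
          have h2 : a⁻¹ • (a • p + b • x + c • dvec D x) = 0 := by rw [habc, smul_zero]
          have h3 : a⁻¹ • a • p = p := by rw [smul_smul, inv_mul_cancel₀ ha, one_smul]
          rw [smul_add, smul_add, h3, add_assoc] at h2
          rw [eq_neg_of_add_eq_zero_left h2]
          module
        by_cases hc : c = 0
        · rw [hc, mul_zero, neg_zero, zero_smul, add_zero] at hpx
          have h3 := hDp
          rw [hpx, dvec_smul] at h3
          have h4 := (hxD _ _ h3).2
          rw [h4, zero_smul] at hpx
          exact hp hpx
        · apply hspan
          refine ⟨-(c⁻¹ * b), -(c⁻¹ * a), ?_⟩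
          have h2 : c⁻¹ • (a • p + b • x + c • dvec D x) = 0 := by rw [habc, smul_zero]
          have h3 : c⁻¹ • c • dvec D x = dvec D x := by
            rw [smul_smul, inv_mul_cancel₀ hc, one_smul]
          rw [smul_add, h3] at h2
          rw [eq_neg_of_add_eq_zero_right h2]
          module
      rw [ha, zero_smul, zero_add] at habc
      exact ⟨ha, hxD b c habc⟩
    have hflat : ∀ a b : Fin 4 → E, grad f p ⬝ᵥ a = 0 → grad f p ⬝ᵥ b = 0 → hess f p a b = 0 :=
      fun a b ha hb => hess_eq_zero_of_grad_dotProduct_eq_zero hf p1 p2 hN hDp p0 hli ha hb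
    have hdp₀ : dvec D₀ p = q₁ := by rw [hdp, hD₀, one_smul]
    have n1 : grad f p ⬝ᵥ q₁ = 0 := by
      have e := congrArg D₀ p0
      rwa [deriv_aeval, hdp₀, map_zero] at e
    -- Flatness makes the gradient stationary on the tangent plane as `p` runs along the cubic. The
    -- gradient therefore kills all successive derivatives of the cubic, and with them every column
    -- of `M`.
    have hstep : ∀ w, grad f p ⬝ᵥ w = 0 → grad f p ⬝ᵥ dvec D₀ w = 0 := by
      intro w hw
      have e := congrArg D₀ hw
      rwa [deriv_grad_dotProduct, hdp₀, hflat _ _ n1 hw, zero_add, map_zero] at e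
    have n2 := hstep _ n1
    rw [hdq₁] at n2
    have n3 := hstep _ n2
    rw [hdq₂, dotProduct_smul] at n3
    have m3 : grad f p ⬝ᵥ colVec E M 3 = 0 := by simpa using n3
    rw [hq₂, dotProduct_add, dotProduct_smul, dotProduct_smul, m3] at n2
    have m2 : grad f p ⬝ᵥ colVec E M 2 = 0 := by simpa using n2
    rw [hq₁, dotProduct_add, dotProduct_add, dotProduct_smul, dotProduct_smul, m3, m2] at n1
    have m1 : grad f p ⬝ᵥ colVec E M 1 = 0 := by simpa using n1
    have m0 : grad f p ⬝ᵥ colVec E M 0 = 0 := by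
      have := hpp
      conv_lhs at this => arg 2; rw [hps, cubicPoint_one_eq]
      simpa [dotProduct_add, dotProduct_smul, m1, m2, m3] using this
    refine hN (eq_zero_of_dotProduct_colVec hM fun j => ?_)
    fin_cases j <;> assumption

/-- A smooth surface stays smooth over an extension field. -/
lemma eq_zero_of_grad_eq_zero [IsAlgClosed K] [CharZero K] (hf : IsSmoothQuintic f)
    (y : Fin 4 → E) (hy : grad f y = 0) : y = 0 := by
  set I : Ideal (MvPolynomial (Fin 4) K) := Ideal.span (Set.range fun i => pderiv i f) with hI
  have hz : ∀ x ∈ zeroLocus K I, x = 0 := by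
    intro x hx
    by_contra hx0
    have hd : ∀ i, eval x (pderiv i f) = 0 := fun i => by
      rw [eval_eq_aeval]
      exact hx _ (Ideal.subset_span ⟨i, rfl⟩)
    have h5 := euler_aeval hf.1 x
    simp only [← eval_eq_aeval, hd, mul_zero, Finset.sum_const_zero] at h5
    obtain ⟨i, hi⟩ := hf.2 x hx0 (by simpa using h5.symm)
    exact hi (hd i)
  funext j
  -- The Nullstellensatz over `K` puts a power of each variable in the ideal of the partial
  -- derivatives, a statement that persists over `E`.
  have hj : (X j : MvPolynomial (Fin 4) K) ∈ I.radical := by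
    rw [← vanishingIdeal_zeroLocus_eq_radical (K := K), mem_vanishingIdeal_iff]
    intro x hx
    rw [hz x hx]
    simp
  obtain ⟨n, hn⟩ := hj
  have hle : I ≤ RingHom.ker (aeval y : MvPolynomial (Fin 4) K →ₐ[K] E) := by
    rw [hI, Ideal.span_le]
    rintro _ ⟨i, rfl⟩
    exact congrFun hy i
  have := hle hn
  rw [RingHom.mem_ker, map_pow, aeval_X] at this
  exact eq_zero_of_pow_eq_zero this

/-- Divisibility would place the generic point of the surface on some `T_p ∩ V_p`. The cases are
whether the parameter of `p` is constant under both derivations or not; the parameter at infinity is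
always constant. -/
lemma not_dvd_zForm {K : Type*} [Field K] [IsAlgClosed K] [CharZero K]
    {f : MvPolynomial (Fin 4) K} (hf : IsSmoothQuintic f) {M : Matrix (Fin 4) (Fin 4) K}
    (hM : M.det ≠ 0) (hC : CubicOnSurface f M) : ¬ f ∣ zForm f M := by
  intro hdvd
  obtain ⟨E, _, _, _, a, b, D₁, D₂, h1a, h1b, h2a, h2b⟩ :=
    exists_algClosed_extension_with_derivations K
  have : CharZero E := charZero_of_injective_algebraMap (algebraMap K E).injective
  have hs := eq_zero_of_grad_eq_zero (E := E) hf
  have hf0 : f ≠ 0 := by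
    rintro rfl
    have := hs 1 (by funext i; simp [grad])
    exact one_ne_zero this
  obtain ⟨x, x0, hxi⟩ := exists_generic_zero (by norm_num) hf.1 hf0 h1a h1b h2a h2b
  have hx : LinearIndependent E ![x, dvec D₁ x, dvec D₂ x] := by
    rw [linearIndependent_triple_iff]
    intro α β γ h
    exact hxi α β γ fun i => congrFun h i
  have hR : aeval x (zForm f M) = 0 := by
    obtain ⟨g, hg⟩ := hdvd
    rw [hg, map_mul, x0, zero_mul]
  obtain ⟨u, hu, ht, hh⟩ := (aeval_zForm_eq_zero_iff hf.1 M x).mp hR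
  have hp := cubicPoint_ne_zero hM hu
  have p0 : aeval (cubicPoint M u) f = 0 := by
    rw [← aeval_aeval_cubicPoint_X]
    have : aeval (cubicPoint M (X : Fin 2 → MvPolynomial (Fin 2) K)) f = 0 :=
      MvPolynomial.funext fun v => by
        rw [eval_eq_aeval, aeval_aeval_cubicPoint_X, ← eval_eq_aeval, hC v, map_zero]
    rw [this, map_zero]
  have p1 : grad f (cubicPoint M u) ⬝ᵥ x = 0 := ht
  have p2 : hess f (cubicPoint M u) x x = 0 := by
    rw [hessianForm] at hh
    have h2 : algebraMap K E (1 / 2) ≠ 0 := by simp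
    rw [← (mul_eq_zero.mp hh).resolve_left h2]
    refine Finset.sum_congr rfl fun i _ => Finset.sum_congr rfl fun j _ => ?_
    ring
  rcases hu with ⟨s, rfl⟩ | rfl
  · by_cases h12 : D₁ s = 0 ∧ D₂ s = 0
    · have hd : ∀ D : Derivation K E E, D s = 0 → dvec D (cubicPoint M ![1, s]) = 0 := by
        intro D hD
        rw [cubicPoint_one_eq]
        simp [dvec_add, dvec_smul, dvec_colVec, Derivation.leibniz_pow, hD]
      exact false_of_constant_point hf.1 hs hp hx x0 p0 p1 p2 (hd _ h12.1) (hd _ h12.2)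
    -- Rescaling a derivation that moves `s` gives differentiation along the cubic at unit speed.
    · obtain ⟨D, hD⟩ : ∃ D : Derivation K E E, D s = 1 := by
        by_cases h1 : D₁ s = 0
        · have h2 : D₂ s ≠ 0 := fun h => h12 ⟨h1, h⟩
          exact ⟨(D₂ s)⁻¹ • D₂, by simp [h2]⟩
        · exact ⟨(D₁ s)⁻¹ • D₁, by simp [h1]⟩
      exact false_of_moving_point hf.1 hs hM rfl hx x0 p0 p1 p2 hD h12
  · have hd : ∀ D : Derivation K E E, dvec D (cubicPoint M ![0, 1]) = 0 := by
      intro D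
      rw [cubicPoint_zero_one, dvec_colVec]
    exact false_of_constant_point hf.1 hs hp hx x0 p0 p1 p2 (hd _) (hd _)

end NoComponent

end TwistedQuintic

theorem proposition7p5 {K : Type*} [Field K] [IsAlgClosed K] [CharZero K]
    (f : MvPolynomial (Fin 4) K) (hf : TwistedQuintic.IsSmoothQuintic f)
    (M : Matrix (Fin 4) (Fin 4) K) (hM : M.det ≠ 0)
    (hC : TwistedQuintic.CubicOnSurface f M)
    (L : Submodule K (Fin 4 → K)) (hL : Module.finrank K L = 2)
    (hLf : ∀ x ∈ L, MvPolynomial.eval x f = 0)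
    (hLC : TwistedQuintic.MeetsCubicTwice M L) :
    (TwistedQuintic.zForm f M).IsHomogeneous 33 ∧
    {x : Fin 4 → K | MvPolynomial.eval x (TwistedQuintic.zForm f M) = 0} =
      TwistedQuintic.zLocus f M ∧
    ¬ f ∣ TwistedQuintic.zForm f M ∧
    2 ≤ TwistedQuintic.intersectionMult
      (MvPolynomial.vanishingIdeal K (L : Set (Fin 4 → K))) f (TwistedQuintic.zForm f M) := by
  refine ⟨TwistedQuintic.zForm_isHomogeneous f M, TwistedQuintic.zeros_zForm_eq_zLocus hf.1 M,
    TwistedQuintic.not_dvd_zForm hf hM hC, ?_⟩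
  refine TwistedQuintic.two_le_intersectionMult L hL ?_ ?_
  · rw [MvPolynomial.mem_vanishingIdeal_iff]
    intro x hx
    rw [← TwistedQuintic.eval_eq_aeval]
    exact hLf x hx
  · rcases hLC with ⟨u, v, huv, hu, hv⟩ | ⟨u, hu, rfl⟩
    · exact TwistedQuintic.zForm_mem_sq_of_secant L hf.1 M hLf huv hu hv
    · exact TwistedQuintic.zForm_mem_sq_of_tangent hf.1 M hu hLf
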